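/- Let $f_i,g_i:\mathbb R^n\to\mathbb R$ be convex and twice differentiable and $h_i:\mathbb R^n\to\mathbb R$ affine ($i=1,\dots,N$). Assume Slater's condition (some $z$ satisfies $g_i(z)<0$ and $h_i(z)=0$ for all $i$) and that the problem $\min_z\sum_i f_i(z)$ s.t. $g_i(z)\le 0,\ h_i(z)=0$ for all $i$ has an optimal solution. Let $[a_{ij}]$ be a weighted adjacency matrix of an undirected connected graph on $\{1,\dots,N\}$ (so $a_{ij}=a_{ji}>0$ if $i,j$ are adjacent and $a_{ij}=0$ otherwise, in particular $a_{ii}=0$), let $L$ be its Laplacian and $\mathbf L=L\otimes I_n$. Let $m\ge 2$, and for each $i$ let $0=b^i_1<b^i_2<\dots<b^i_m$ and $c^i_1,\dots,c^i_m>0$. Consider the system with state $(\rho,\xi,\lambda,\mu)$, where $\rho^i_k,\xi_i\in\mathbb R^n$ and $\lambda_i,\mu_i\in\mathbb R$: $$\dot\rho^i_k=-b^i_k\rho^i_k+c^i_k\nu_i\ (k=1,\dots,m),\qquad \dot\xi_i=\sum_j a_{ij}(x_j-x_i),\qquad \dot\lambda_i=2\lambda_i g_i(x_i),\qquad \dot\mu_i=h_i(x_i),$$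 $$x_i=\sum_{k=1}^m\rho^i_k,\qquad \nu_i=-\nabla f_i(x_i)-\lambda_i^2\nabla g_i(x_i)-\mu_i\nabla h_i(x_i)+\sum_j a_{ij}(x_j-x_i)-\sum_j a_{ij}(\xi_j-\xi_i)$$ (the first equation together with $x_i=\sum_k\rho^i_k$ realizes the transfer function $M_i(s)=\sum_k c^i_k/(s+b^i_k)$ from $\nu_i$ to $x_i$). Then every trajectory of this system on $[0,\infty)$ with $\lambda_i(0)>0$ for all $i$ converges, as $t\to\infty$, to a single equilibrium $(\rho^*,\xi^*,\lambda^*,\mu^*)$ (which may depend on the trajectory). With $x_i^*=\sum_k\rho^{i*}_k$, this equilibrium satisfies the generalized KKT conditions $$\mathbf Lx^*=0,\qquad h_i(x_i^*)=0,\quad g_i(x_i^*)\le 0,\quad (\lambda_i^*)^2g_i(x_i^*)=0,$$ $$\nabla f_i(x_i^*)+(\lambda_i^*)^2\nabla g_i(x_i^*)+\mu_i^*\nabla h_i(x_i^*)+\sum_j a_{ij}(\xi_j^*-\xi_i^*)=0\qquad(i=1,\dots,N),$$ and $x^*$ solves the consensus-reformulated problem $\min_x\ \sum_i f_i(x_i)+x^T\mathbf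 Lx$ s.t. $g_i(x_i)\le0,\ h_i(x_i)=0$ for all $i$, and $\mathbf Lx=0$. -/

import Mathlib

namespace DistOpt

/-- The decision space `ℝⁿ` with its Euclidean norm. -/
abbrev E (n : ℕ) : Type := EuclideanSpace ℝ (Fin n)

/-- The data of the problem `min ∑ᵢ fᵢ(z)  s.t.  gᵢ(z) ≤ 0, hᵢ(z) = 0` for `N` agents,
the equality constraints being affine. -/
structure Problem (N n : ℕ) where
  /-- local objective functions -/
  f : Fin N → E n → ℝ
  /-- local inequality constraints -/
  g : Fin N → E n → ℝ
  /-- local affine equality constraints -/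
  h : Fin N → (E n →ᵃ[ℝ] ℝ)

/-- `φ` is differentiable everywhere and so is its derivative. -/
def TwiceDifferentiable {n : ℕ} (φ : E n → ℝ) : Prop :=
  Differentiable ℝ φ ∧ Differentiable ℝ (fderiv ℝ φ)

namespace Problem

variable {N n : ℕ}

/-- `z` satisfies all the constraints of the original problem. -/
def Feasible (P : Problem N n) (z : E n) : Prop :=
  ∀ i, P.g i z ≤ 0 ∧ P.h i z = 0

/-- `z` is an optimal solution of the original problem. -/
def IsOptimal (P : Problem N n) (z : E n) : Prop :=
  P.Feasible z ∧ ∀ w, P.Feasible w → ∑ i, P.f i z ≤ ∑ i, P.f i w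

/-- Slater's condition: some point satisfies the equality constraints and satisfies
the inequality constraints strictly. -/
def Slater (P : Problem N n) : Prop :=
  ∃ z, ∀ i, P.g i z < 0 ∧ P.h i z = 0

end Problem

/-- `a` is a weighted adjacency matrix of the undirected graph `G`. -/
structure IsWeightedAdjacency {N : ℕ} (G : SimpleGraph (Fin N))
    (a : Matrix (Fin N) (Fin N) ℝ) : Prop where
  symm : ∀ i j, a i j = a j i
  pos : ∀ i j, G.Adj i j → 0 < a i j
  zero : ∀ i j, ¬ G.Adj i j → a i j = 0

/-- The graph Laplacian `L = diag(A 𝟏) - A`. -/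
def laplacian {N : ℕ} (a : Matrix (Fin N) (Fin N) ℝ) : Matrix (Fin N) (Fin N) ℝ :=
  Matrix.diagonal (a.mulVec 1) - a

/-- The action of `𝐋 = L ⊗ Iₙ` on `x = col(x₁, …, x_N)`: its `i`-th block is `∑ⱼ Lᵢⱼ xⱼ`. -/
def lapl {N n : ℕ} (a : Matrix (Fin N) (Fin N) ℝ) (x : Fin N → E n) : Fin N → E n :=
  fun i => ∑ j, laplacian a i j • x j

namespace Problem

variable {N n : ℕ}

/-- The constraints of the consensus reformulation:
`gᵢ(xᵢ) ≤ 0`, `hᵢ(xᵢ) = 0` for all `i`, and `𝐋 x = 0`. -/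
def ConsensusFeasible (P : Problem N n) (a : Matrix (Fin N) (Fin N) ℝ)
    (x : Fin N → E n) : Prop :=
  (∀ i, P.g i (x i) ≤ 0 ∧ P.h i (x i) = 0) ∧ lapl a x = 0

/-- The objective `∑ᵢ fᵢ(xᵢ) + xᵀ 𝐋 x` of the consensus reformulation. -/
noncomputable def consensusObjective (P : Problem N n) (a : Matrix (Fin N) (Fin N) ℝ)
    (x : Fin N → E n) : ℝ :=
  ∑ i, P.f i (x i) + ∑ i, inner ℝ (x i) (lapl a x i)

/-- `x` solves the consensus reformulation. -/
def SolvesConsensus (P : Problem N n) (a : Matrix (Fin N) (Fin N) ℝ)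
    (x : Fin N → E n) : Prop :=
  P.ConsensusFeasible a x ∧
    ∀ y, P.ConsensusFeasible a y → P.consensusObjective a x ≤ P.consensusObjective a y

/-- The generalized KKT conditions, with multiplier `λᵢ²` for `gᵢ ≤ 0`. -/
def GeneralizedKKT (P : Problem N n) (a : Matrix (Fin N) (Fin N) ℝ)
    (x ξ : Fin N → E n) (lam μ : Fin N → ℝ) : Prop :=
  lapl a x = 0 ∧
  (∀ i, P.h i (x i) = 0 ∧ P.g i (x i) ≤ 0 ∧ lam i ^ 2 * P.g i (x i) = 0) ∧
  (∀ i, gradient (P.f i) (x i) + lam i ^ 2 • gradient (P.g i) (x i)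
      + μ i • gradient (P.h i) (x i) + ∑ j, a i j • (ξ j - ξ i) = 0)

end Problem

/-- The admissible coefficients of `M(s) = ∑ₖ cₖ / (s + bₖ)`:
`m ≥ 2`, `0 = b₁ < b₂ < … < b_m` and `cₖ > 0` (indices shifted to start from `0`). -/
structure IsCompensator {m : ℕ} (b c : Fin m → ℝ) : Prop where
  two_le : 2 ≤ m
  strictMono : StrictMono b
  zero : ∀ k : Fin m, (k : ℕ) = 0 → b k = 0
  pos : ∀ k, 0 < c k

/-- The state `(ρ, ξ, λ, μ)` of the algorithm. -/
abbrev State (N m n : ℕ) : Type :=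
  (Fin N → Fin m → E n) × (Fin N → E n) × (Fin N → ℝ) × (Fin N → ℝ)

namespace State

variable {N m n : ℕ}

/-- The compensator states `ρᵢₖ`. -/
def rho (s : State N m n) : Fin N → Fin m → E n := s.1

/-- The consensus multipliers `ξᵢ`. -/
def xi (s : State N m n) : Fin N → E n := s.2.1

/-- The variables `λᵢ`. -/
def lam (s : State N m n) : Fin N → ℝ := s.2.2.1

/-- The equality multipliers `μᵢ`. -/
def mu (s : State N m n) : Fin N → ℝ := s.2.2.2

/-- The outputs `xᵢ = ∑ₖ ρᵢₖ`. -/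
def x (s : State N m n) : Fin N → E n := fun i => ∑ k, s.rho i k

end State

/-- The signal `νᵢ` which is fed to the compensator of agent `i`. -/
noncomputable def nu {N m n : ℕ} (P : Problem N n) (a : Matrix (Fin N) (Fin N) ℝ)
    (s : State N m n) (i : Fin N) : E n :=
  - gradient (P.f i) (s.x i) - s.lam i ^ 2 • gradient (P.g i) (s.x i)
    - s.mu i • gradient (P.h i) (s.x i)
    + ∑ j, a i j • (s.x j - s.x i) - ∑ j, a i j • (s.xi j - s.xi i)

/-- The right-hand side of the algorithm. -/
noncomputable def field {N m n : ℕ} (P : Problem N n) (a : Matrix (Fin N) (Fin N) ℝ)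
    (b c : Fin N → Fin m → ℝ) (s : State N m n) : State N m n :=
  (fun i k => - (b i k • s.rho i k) + c i k • nu P a s i,
   fun i => ∑ j, a i j • (s.x j - s.x i),
   fun i => 2 * s.lam i * P.g i (s.x i),
   fun i => P.h i (s.x i))

/-- `X` is a trajectory of the algorithm on `[0, ∞)` (one-sided derivative at `0`). -/
def IsTrajectory {N m n : ℕ} (P : Problem N n) (a : Matrix (Fin N) (Fin N) ℝ)
    (b c : Fin N → Fin m → ℝ) (X : ℝ → State N m n) : Prop :=
  ∀ t, 0 ≤ t → HasDerivWithinAt X (field P a b c (X t)) (Set.Ici 0) t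

/-- `s` is an equilibrium of the algorithm. -/
def IsEquilibrium {N m n : ℕ} (P : Problem N n) (a : Matrix (Fin N) (Fin N) ℝ)
    (b c : Fin N → Fin m → ℝ) (s : State N m n) : Prop :=
  field P a b c s = 0

end DistOpt

/-!
Fix a reference state `e` and write `m` for the multipliers `(ξ, λ, μ)` of a state. The Lyapunov
function `lyapunov c e` is the sum of the squared distances of `ρ`, `ξ`, `μ` from those of `e`
(with weights for `ρ`) and of a Kullback–Leibler divergence between the values of `λ²`
(`barrier`); its form for `λ` is what makes `λ' = 2 λ g` a gradient-like flow. By convexity its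
derivative along the algorithm is at most `-dissipation + Lag(e.x, m) - Lag(x, e.m)`, where the
dissipation is `∑ (bₖ / cₖ) ‖ρₖ‖² + xᵀ 𝐋 x` (`lyapunovRate_le`). It is therefore nonincreasing
whenever `e.x` is feasible and the dual function at `e.m` is at least the objective value of
`e.x`. Such an `e` exists by Lagrange duality under Slater's condition (`exists_dual_optimal`),
so trajectories are bounded.

Then Barbalat's lemma gives `dissipation → 0`, `ν → 0` and `x' → 0`. Since `x` varies slowly and
`μ`, `log λ` are bounded above, `h(x) → 0`, and `λᵢ gᵢ(xᵢ) = 0` at all limit points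
(`eventually_abs_le_of_slowly_varying`). Hence limit points satisfy every KKT condition except
possibly `gᵢ ≤ 0`: a spurious equilibrium with `λᵢ = 0` and `gᵢ > 0` has to be excluded. This is
the main difficulty, and it takes two observations.

* The multipliers of any limit point are dual optimal. Combined with the outputs of a fixed
  optimal `e` they form an admissible reference state, and comparing the limits of the resulting
  Lyapunov functions at two limit points shows that `λ` converges (`limit_lam_unique`,
  `tendsto_lam`).
* If `gⱼ > 0` at a limit point `Y`, then `λⱼ → 0`. Near `Y` the Lyapunov function relative to
  `Y` can increase only through such `j`, and by no more than `∑ λⱼ² / 2` does, which is small.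
  So the trajectory stays near `Y`, where `λⱼ` does not decrease, contradicting `λⱼ → 0`
  (`limit_g_nonpos`).

So a limit point is a genuine equilibrium, the Lyapunov function relative to it is nonincreasing
and tends to `0` along the filter that defines the limit point, hence the whole trajectory
converges to it (`tendsto_limit`). No existence, uniqueness or continuity of a flow is used:
gradients of twice differentiable convex functions need not be locally Lipschitz.
-/

namespace DistOpt

open Filter Set Topology

/-! ### Analysis on the half-line -/

/-- The tangent plane of a convex function lies below its graph. -/
theorem convexOn_add_fderiv_le {F : Type*} [NormedAddCommGroup F] [NormedSpace ℝ F]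
    {φ : F → ℝ} (hφ : ConvexOn ℝ univ φ) {φ' : F →L[ℝ] ℝ} {x : F}
    (hx : HasFDerivAt φ φ' x) (y : F) : φ x + φ' (y - x) ≤ φ y := by
  have hc : ConvexOn ℝ univ (φ ∘ AffineMap.lineMap (k := ℝ) x y) := by
    simpa using hφ.comp_affineMap (AffineMap.lineMap (k := ℝ) x y)
  have hd : HasDerivAt (φ ∘ AffineMap.lineMap (k := ℝ) x y) (φ' (y - x)) 0 := by
    refine HasFDerivAt.comp_hasDerivAt (x := (0 : ℝ)) (l := φ) (l' := φ') ?_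
      AffineMap.hasDerivAt_lineMap
    simpa using hx
  have := hc.le_slope_of_hasDerivAt (mem_univ 0) (mem_univ 1) zero_lt_one hd
  simp only [slope_def_field, Function.comp_apply, AffineMap.lineMap_apply_one,
    AffineMap.lineMap_apply_zero, sub_zero, div_one] at this
  linarith

theorem convexOn_add_inner_gradient_le {F : Type*} [NormedAddCommGroup F] [InnerProductSpace ℝ F]
    [CompleteSpace F] {φ : F → ℝ} (hφ : ConvexOn ℝ univ φ) (hd : Differentiable ℝ φ) (x y : F) :
    φ x + inner ℝ (gradient φ x) (y - x) ≤ φ y := by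
  simpa using convexOn_add_fderiv_le hφ (hd x).hasGradientAt.hasFDerivAt y

theorem antitoneOn_of_hasDerivWithinAt_Ici {u w : ℝ → ℝ} {T : ℝ} (hT : 0 ≤ T)
    (hu : ∀ t, 0 ≤ t → HasDerivWithinAt u (w t) (Ici 0) t) {s : Set ℝ} (hs : Convex ℝ s)
    (hsT : s ⊆ Ici T) (hw : ∀ t ∈ s, w t ≤ 0) : AntitoneOn u s := by
  have h0 : s ⊆ Ici 0 := fun t ht => hT.trans (hsT ht)
  refine antitoneOn_of_hasDerivWithinAt_nonpos (f' := w) hs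
    (fun t ht => ((hu t (h0 ht)).mono h0).continuousWithinAt)
    (fun t ht => ((hu t (h0 (interior_subset ht))).mono (interior_subset.trans h0)))
    (fun t ht => hw t (interior_subset ht))

/-- The mean value inequality with respect to a fixed candidate derivative. -/
theorem norm_sub_sub_smul_le {F : Type*} [NormedAddCommGroup F] [NormedSpace ℝ F]
    {u w : ℝ → F} (hu : ∀ t, 0 ≤ t → HasDerivWithinAt u (w t) (Ici 0) t) {t s C : ℝ} {v : F}
    (ht : 0 ≤ t) (hts : t ≤ s) (hC : ∀ r ∈ Icc t s, ‖w r - v‖ ≤ C) :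
    ‖u s - u t - (s - t) • v‖ ≤ C * (s - t) := by
  have h := (convex_Icc t s).norm_image_sub_le_of_norm_hasDerivWithin_le
    (f := fun r => u r - r • v) (f' := fun r => w r - v) (C := C)
    (fun r hr => by
      have := ((hu r (ht.trans hr.1)).mono (s := Icc t s) (fun q hq => ht.trans hq.1)).sub
        (((hasDerivAt_id r).smul_const v).hasDerivWithinAt (s := Icc t s))
      rw [one_smul] at this
      exact this) hC (left_mem_Icc.2 hts) (right_mem_Icc.2 hts)
  rw [Real.norm_of_nonneg (sub_nonneg.2 hts)] at h
  convert h using 2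
  rw [sub_smul]; abel

/-- **Barbalat's lemma**: if `u` converges and `u'` is uniformly continuous then `u'` tends
to `0`. -/
theorem tendsto_zero_of_uniformContinuousOn_deriv {F : Type*} [NormedAddCommGroup F]
    [NormedSpace ℝ F] {u w : ℝ → F} (hu : ∀ t, 0 ≤ t → HasDerivWithinAt u (w t) (Ici 0) t)
    (hw : UniformContinuousOn w (Ici 0)) {l : F} (hl : Tendsto u atTop (𝓝 l)) :
    Tendsto w atTop (𝓝 0) := by
  rw [Metric.tendsto_atTop]
  intro ε hε
  obtain ⟨δ, hδ, hwδ⟩ := Metric.uniformContinuousOn_iff.1 hw (ε / 3) (by positivity)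
  have hdiff : Tendsto (fun t => u (t + δ / 2) - u t) atTop (𝓝 0) := by
    simpa using (hl.comp (tendsto_atTop_add_const_right atTop (δ / 2) tendsto_id)).sub hl
  obtain ⟨T, hT⟩ := Metric.tendsto_atTop.1 hdiff (δ / 2 * (ε / 3)) (by positivity)
  refine ⟨max T 0, fun t ht => ?_⟩
  have ht0 : 0 ≤ t := (le_max_right _ _).trans ht
  have h1 := norm_sub_sub_smul_le hu (s := t + δ / 2) (v := w t) (C := ε / 3) ht0 (by linarith)
    (fun r hr => by
      rw [← dist_eq_norm]
      refine (hwδ r (ht0.trans hr.1) t ht0 ?_).le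
      rw [Real.dist_eq, abs_of_nonneg (by linarith [hr.1])]
      linarith [hr.2])
  have h2 := hT t ((le_max_left _ _).trans ht)
  rw [dist_zero_right] at h2 ⊢
  simp only [add_sub_cancel_left] at h1
  have h3 : ‖(δ / 2) • w t‖ ≤ ‖u (t + δ / 2) - u t - (δ / 2) • w t‖ + ‖u (t + δ / 2) - u t‖ := by
    rw [add_comm, ← norm_neg (u (t + δ / 2) - u t - (δ / 2) • w t)]
    refine le_trans (le_of_eq ?_) (norm_add_le _ _)
    congr 1; abel
  rw [norm_smul, Real.norm_of_nonneg (by positivity)] at h3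
  have h4 : δ / 2 * ‖w t‖ < δ / 2 * ε := by nlinarith
  exact lt_of_mul_lt_mul_left h4 (by positivity)

/-- If `u` is bounded above and its derivative `w` varies slowly at infinity, then `w` is small at
all late times at which `u` is not too negative. Otherwise `w` would keep its sign and size on a
long interval after (or before) such a time, and `u` would exceed its bound at the end
(or at the start) of that interval. -/
theorem eventually_abs_le_of_slowly_varying {u w : ℝ → ℝ}
    (hu : ∀ t, 0 ≤ t → HasDerivWithinAt u (w t) (Ici 0) t)
    (hw : ∀ ε > 0, ∃ T, ∀ t s, T ≤ t → t ≤ s → |w s - w t| ≤ ε * (s - t))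
    {M : ℝ} (hM : ∀ t, 0 ≤ t → u t ≤ M) (K : ℝ) {ε : ℝ} (hε : 0 < ε) :
    ∀ᶠ t in atTop, -K ≤ u t → |w t| ≤ ε := by
  -- an increase of `u` by `ε / 2` per unit time over a time `ℓ` exceeds `M + K`
  set ℓ : ℝ := 2 * (|M + K| + 1) / ε with hℓ
  have hℓ0 : 0 < ℓ := by positivity
  have hℓM : M + K < ℓ * (ε / 2) := by
    have : ℓ * (ε / 2) = |M + K| + 1 := by rw [hℓ]; field_simp
    rw [this]; linarith [le_abs_self (M + K)]
  obtain ⟨T, hT⟩ := hw (ε / (2 * ℓ)) (by positivity)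
  filter_upwards [eventually_ge_atTop (max T 0 + ℓ)] with t ht hut
  have htT : T ≤ t - ℓ := by linarith [le_max_left T 0]
  have ht0 : 0 ≤ t - ℓ := by linarith [le_max_right T 0]
  have hsmall : ∀ d, d ≤ ℓ → ε / (2 * ℓ) * d ≤ ε / 2 := by
    intro d hd
    calc ε / (2 * ℓ) * d ≤ ε / (2 * ℓ) * ℓ := by gcongr
      _ = ε / 2 := by field_simp
  by_contra! hcon
  rcases lt_abs.1 hcon with h | h
  · have h1 := norm_sub_sub_smul_le hu (t := t) (s := t + ℓ) (v := w t) (C := ε / 2) (by linarith)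
      (by linarith) (fun r hr =>
        (hT t r (by linarith) hr.1).trans (hsmall _ (by linarith [hr.2])))
    have h2 := (abs_le.1 h1).1
    have h3 := hM (t + ℓ) (by linarith)
    simp only [add_sub_cancel_left, smul_eq_mul] at h2
    nlinarith
  · have h1 := norm_sub_sub_smul_le hu (t := t - ℓ) (s := t) (v := w t) (C := ε / 2) ht0
      (by linarith) (fun r hr => by
        rw [← norm_neg, neg_sub]
        exact (hT r t (by linarith [hr.1]) hr.2).trans (hsmall _ (by linarith [hr.1])))
    have h2 := (abs_le.1 h1).2
    have h3 := hM (t - ℓ) ht0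
    simp only [sub_sub_cancel, smul_eq_mul] at h2
    nlinarith

/-- A bootstrap principle: a bound that is strict at time `T` and that improves itself at every
later time can never be lost. -/
theorem forall_lt_of_bootstrap {φ : ℝ → ℝ} {T θ : ℝ} (hφ : ContinuousOn φ (Ici T)) (hT : φ T < θ)
    (hb : ∀ t, T ≤ t → (∀ s ∈ Icc T t, φ s ≤ θ) → φ t < θ) : ∀ t, T ≤ t → φ t < θ := by
  intro t ht
  by_contra! hcon
  have hcl : IsCompact (Icc T t ∩ φ ⁻¹' Ici θ) :=
    isCompact_Icc.of_isClosed_subset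
      ((hφ.mono Icc_subset_Ici_self).preimage_isClosed_of_isClosed isClosed_Icc isClosed_Ici)
      inter_subset_left
  obtain ⟨r, ⟨hr, hrθ⟩, hmin⟩ := hcl.exists_isLeast ⟨t, right_mem_Icc.2 ht, hcon⟩
  have hlt : ∀ s, T ≤ s → s < r → φ s < θ := by
    intro s hs hsr
    by_contra! h
    exact absurd (hmin ⟨⟨hs, hsr.le.trans hr.2⟩, h⟩) (not_le.2 hsr)
  have hTr : T < r := by
    refine lt_of_le_of_ne hr.1 ?_
    rintro rfl
    exact absurd hT (not_lt.2 hrθ)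
  have hle : φ r ≤ θ := by
    have hc : Tendsto φ (𝓝[Ico T r] r) (𝓝 (φ r)) :=
      (hφ r hr.1).mono_left (nhdsWithin_mono _ Ico_subset_Ici_self)
    have : (𝓝[Ico T r] r).NeBot := by
      rw [← mem_closure_iff_nhdsWithin_neBot, closure_Ico hTr.ne]
      exact right_mem_Icc.2 hTr.le
    exact le_of_tendsto hc (eventually_nhdsWithin_of_forall fun s hs => (hlt s hs.1 hs.2).le)
  refine absurd (hb r hr.1 fun s hs => ?_) (not_lt.2 hrθ)
  rcases hs.2.lt_or_eq with h | rfl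
  · exact (hlt s hs.1 h).le
  · exact hle

/-- A solution of the scalar linear equation `u' = w u` on the half-line keeps its sign. -/
theorem pos_of_hasDerivWithinAt_mul {u w : ℝ → ℝ} (hw : ContinuousOn w (Ici 0))
    (hu : ∀ t, 0 ≤ t → HasDerivWithinAt u (w t * u t) (Ici 0) t) (h0 : 0 < u 0) :
    ∀ t, 0 ≤ t → 0 < u t := by
  -- `W` is a primitive of `w`, extended to negative times by the constant `w 0`
  have hwc : Continuous fun t => w (max t 0) :=
    hw.comp_continuous (by fun_prop) fun t => le_max_right t 0
  set W : ℝ → ℝ := fun t => ∫ s in (0 : ℝ)..t, w (max s 0) with hW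
  have hWd : ∀ t, HasDerivAt W (w (max t 0)) t := fun t =>
    intervalIntegral.integral_hasDerivAt_right (hwc.intervalIntegrable _ _)
      hwc.stronglyMeasurable.stronglyMeasurableAtFilter hwc.continuousAt
  have hv : ∀ t, 0 ≤ t →
      HasDerivWithinAt (fun t => u t * Real.exp (-W t)) 0 (Ici 0) t := by
    intro t ht
    have h := (hu t ht).mul ((hWd t).neg.exp.hasDerivWithinAt (s := Ici 0))
    rw [max_eq_left ht] at h
    refine h.congr_deriv ?_
    ring
  intro t ht
  have hconst : u t * Real.exp (-W t) = u 0 * Real.exp (-W 0) := by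
    refine (convex_Ici (0 : ℝ)).is_const_of_fderivWithin_eq_zero (𝕜 := ℝ)
      (f := fun t => u t * Real.exp (-W t)) (fun s hs => (hv s hs).differentiableWithinAt)
      (fun s hs => ?_) ht (mem_Ici.2 le_rfl)
    have := (hv s hs).hasFDerivWithinAt.fderivWithin ((uniqueDiffOn_Ici (0 : ℝ)) s hs)
    rw [this]; ext; simp
  have hp : 0 < u t * Real.exp (-W t) := by rw [hconst]; positivity
  exact pos_of_mul_pos_left hp (Real.exp_pos _).le

/-! ### Lagrange multipliers for convex programs -/

/-- Slater's theorem on the affine set `T = 0`: the inequality constraints have multipliers. They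
come from a hyperplane that separates `(0, φ x)` from the open convex set of all pairs `(u, w)`
with `ψ i y < u i` and `φ y < w` for some `y` with `T y = 0`. -/
theorem exists_inequality_multipliers {V W ι : Type*} [AddCommGroup V] [Module ℝ V]
    [AddCommGroup W] [Module ℝ W] [Fintype ι] {φ : V → ℝ} {ψ : ι → V → ℝ}
    (hφ : ConvexOn ℝ univ φ) (hψ : ∀ i, ConvexOn ℝ univ (ψ i)) (T : V →ᵃ[ℝ] W) {z : V}
    (hz : T z = 0) (hzψ : ∀ i, ψ i z < 0) {p : ℝ}
    (hp : ∀ y, T y = 0 → (∀ i, ψ i y ≤ 0) → p ≤ φ y) :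
    ∃ α : ι → ℝ, (∀ i, 0 ≤ α i) ∧ ∀ y, T y = 0 → p ≤ φ y + ∑ i, α i * ψ i y := by
  classical
  set A : Set ((ι → ℝ) × ℝ) := {q | ∃ y, T y = 0 ∧ (∀ i, ψ i y < q.1 i) ∧ φ y < q.2} with hA
  have hAo : IsOpen A := by
    have : A = ⋃ y ∈ {y | T y = 0}, {q : (ι → ℝ) × ℝ | (∀ i, ψ i y < q.1 i) ∧ φ y < q.2} := by
      ext q; simp [hA, and_left_comm]
    rw [this]
    refine isOpen_biUnion fun y _ => IsOpen.and ?_ ?_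
    · simp only [ofPred_forall]
      exact isOpen_iInter_of_finite fun i => isOpen_lt continuous_const (by fun_prop)
    · exact isOpen_lt continuous_const continuous_snd
  have hAc : Convex ℝ A := by
    rintro q ⟨y, hy, hyψ, hyφ⟩ q' ⟨y', hy', hyψ', hyφ'⟩ s r hs hr hsr
    have key : ∀ {a b a' b' : ℝ}, a < a' → b < b' → s * a + r * b < s * a' + r * b' := by
      intro a b a' b' h h'
      rcases hs.eq_or_lt with rfl | hs
      · have : r = 1 := by linarith
        subst this; simpa using h'
      · have := mul_lt_mul_of_pos_left h hs
        have := mul_le_mul_of_nonneg_left h'.le hr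
        linarith
    refine ⟨s • y + r • y', ?_, fun i => ?_, ?_⟩
    · rw [Convex.combo_affine_apply hsr, hy, hy']; simp
    · exact ((hψ i).2 (mem_univ y) (mem_univ y') hs hr hsr).trans_lt (key (hyψ i) (hyψ' i))
    · exact (hφ.2 (mem_univ y) (mem_univ y') hs hr hsr).trans_lt (key hyφ hyφ')
  have hpA : ((0 : ι → ℝ), p) ∉ A := by
    rintro ⟨y, hy, hyψ, hyφ⟩
    exact absurd (hp y hy fun i => (hyψ i).le) (not_le.2 hyφ)
  obtain ⟨l, hl⟩ := geometric_hahn_banach_open_point hAc hAo hpA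
  set β : ι → ℝ := fun i => l (Pi.single i 1, 0) with hβ
  set γ : ℝ := l (0, 1) with hγ
  have hl' : ∀ u w, l (u, w) = ∑ i, β i * u i + γ * w := by
    intro u w
    have h1 : (u, w) = ∑ i, u i • ((Pi.single i 1 : ι → ℝ), (0 : ℝ))
        + w • ((0 : ι → ℝ), (1 : ℝ)) := by
      ext j
      · simp [Prod.fst_sum, Finset.sum_apply, Pi.single_apply]
      · simp [Prod.snd_sum]
    rw [h1, map_add, map_sum, map_smul, smul_eq_mul, mul_comm w]
    congr 1
    exact Finset.sum_congr rfl fun i _ => by rw [map_smul, smul_eq_mul, mul_comm]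
  have hsep : ∀ y, T y = 0 → ∀ (u : ι → ℝ) (w : ℝ), (∀ i, ψ i y < u i) → φ y < w →
      ∑ i, β i * u i + γ * w < γ * p := by
    intro y hy u w hu hw
    have := hl (u, w) ⟨y, hy, hu, hw⟩
    simpa [hl'] using this
  have hray : ∀ {b₀ b₁ b₂ : ℝ}, (∀ t, 0 ≤ t → b₀ + t * b₁ < b₂) → b₁ ≤ 0 := by
    intro b₀ b₁ b₂ h
    by_contra! hb
    have := h ((|b₂ - b₀|) / b₁) (by positivity)
    rw [div_mul_cancel₀ _ hb.ne'] at this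
    linarith [le_abs_self (b₂ - b₀)]
  have hγ0 : γ ≤ 0 := hray (b₀ := γ * (φ z + 1)) (b₂ := γ * p) fun t ht => by
    have := hsep z hz 0 (φ z + 1 + t) hzψ (by linarith)
    simp only [Pi.zero_apply, mul_zero, Finset.sum_const_zero, zero_add] at this
    linarith
  have hβ0 : ∀ i, β i ≤ 0 := fun i =>
    hray (b₀ := γ * (φ z + 1)) (b₂ := γ * p) fun t ht => by
      have := hsep z hz (Pi.single i t) (φ z + 1) (fun j => (hzψ j).trans_le (by
        rcases eq_or_ne j i with rfl | h
        · simpa using ht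
        · simp [h])) (by linarith)
      rw [Finset.sum_eq_single i (by intro j _ h; simp [h]) (by simp)] at this
      simp only [Pi.single_eq_same] at this
      linarith
  -- the hyperplane is not vertical, by Slater's condition
  have hγ1 : γ < 0 := by
    refine lt_of_le_of_ne hγ0 fun h => ?_
    have := hsep z hz (fun i => ψ i z / 2) (φ z + 1) (fun i => by linarith [hzψ i]) (by linarith)
    rw [h] at this
    have h2 : 0 ≤ ∑ i, β i * (ψ i z / 2) :=
      Finset.sum_nonneg fun i _ => mul_nonneg_of_nonpos_of_nonpos (hβ0 i) (by linarith [hzψ i])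
    linarith
  refine ⟨fun i => β i / γ, fun i => div_nonneg_of_nonpos (hβ0 i) hγ0, fun y hy => ?_⟩
  have hle : ∑ i, β i * ψ i y + γ * φ y ≤ γ * p := by
    have hlim : Tendsto (fun δ : ℝ => ∑ i, β i * (ψ i y + δ) + γ * (φ y + δ)) (𝓝[>] 0)
        (𝓝 (∑ i, β i * (ψ i y + 0) + γ * (φ y + 0))) :=
      (Continuous.tendsto (by fun_prop) _).mono_left nhdsWithin_le_nhds
    simp only [add_zero] at hlim
    refine le_of_tendsto hlim (eventually_nhdsWithin_of_forall fun δ hδ => ?_)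
    have hδ' : (0 : ℝ) < δ := hδ
    exact (hsep y hy _ _ (fun i => by linarith) (by linarith)).le
  have h3 : φ y + ∑ i, β i / γ * ψ i y = (∑ i, β i * ψ i y + γ * φ y) / γ := by
    rw [add_div, mul_div_cancel_left₀ _ hγ1.ne, Finset.sum_div, add_comm]
    congr 1
    exact Finset.sum_congr rfl fun i _ => by ring
  rw [h3, le_div_iff_of_neg hγ1]
  linarith

/-- Lagrange multipliers for a differentiable convex program with affine equality constraints
`T = 0` under Slater's condition. The derivative of the partial Lagrangian at the optimum vanishes
on the directions of `T = 0`, hence factors through the linear part of `T`. -/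
theorem exists_multipliers {V W ι : Type*} [NormedAddCommGroup V] [NormedSpace ℝ V]
    [AddCommGroup W] [Module ℝ W] [Fintype ι] {φ : V → ℝ} {ψ : ι → V → ℝ}
    (hφ : ConvexOn ℝ univ φ) (hφd : Differentiable ℝ φ)
    (hψ : ∀ i, ConvexOn ℝ univ (ψ i)) (hψd : ∀ i, Differentiable ℝ (ψ i)) (T : V →ᵃ[ℝ] W)
    {z : V} (hz : T z = 0) (hzψ : ∀ i, ψ i z < 0)
    {x : V} (hx : T x = 0) (hxψ : ∀ i, ψ i x ≤ 0)
    (hmin : ∀ y, T y = 0 → (∀ i, ψ i y ≤ 0) → φ x ≤ φ y) :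
    ∃ (α : ι → ℝ) (Λ : W →ₗ[ℝ] ℝ), (∀ i, 0 ≤ α i) ∧
      ∀ y, φ x ≤ φ y + ∑ i, α i * ψ i y + Λ (T y) := by
  obtain ⟨α, hα, hp⟩ := exists_inequality_multipliers hφ hψ T hz hzψ hmin
  set Φ : V → ℝ := fun y => φ y + ∑ i, α i * ψ i y with hΦ
  have hΦx : Φ x = φ x := by
    refine le_antisymm ?_ (hp x hx)
    have : ∑ i, α i * ψ i x ≤ 0 :=
      Finset.sum_nonpos fun i _ => mul_nonpos_of_nonneg_of_nonpos (hα i) (hxψ i)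
    simp only [hΦ]; linarith
  have hΦc : ConvexOn ℝ univ Φ := by
    refine hφ.add ⟨convex_univ, fun u _ v _ s r hs hr hsr => ?_⟩
    simp only [smul_eq_mul, Finset.mul_sum, ← Finset.sum_add_distrib]
    refine Finset.sum_le_sum fun i _ => ?_
    have := mul_le_mul_of_nonneg_left ((hψ i).2 (mem_univ u) (mem_univ v) hs hr hsr) (hα i)
    simp only [smul_eq_mul] at this
    linarith
  have hΦd : Differentiable ℝ Φ :=
    hφd.add (Differentiable.fun_sum fun i _ => (hψd i).const_mul (α i))
  set D := fderiv ℝ Φ x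
  have hker : LinearMap.ker T.linear ≤ LinearMap.ker (D : V →ₗ[ℝ] ℝ) := by
    intro v hv
    rw [LinearMap.mem_ker] at hv ⊢
    have hline : HasDerivAt (fun t : ℝ => Φ (x + t • v)) (D v) 0 := by
      have h1 : HasDerivAt (fun t : ℝ => x + t • v) v 0 := by
        simpa using ((hasDerivAt_id (0 : ℝ)).smul_const v).const_add x
      refine HasFDerivAt.comp_hasDerivAt (x := (0 : ℝ)) (l := Φ) (l' := D) ?_ h1
      simpa using (hΦd x).hasFDerivAt
    have hm : IsLocalMin (fun t : ℝ => Φ (x + t • v)) 0 := by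
      refine Eventually.of_forall fun t => ?_
      have hT : T (x + t • v) = 0 := by
        have := T.map_vadd x (t • v)
        rw [vadd_eq_add, add_comm] at this
        rw [this, map_smul, hv, hx]; simp
      simpa [hΦx] using hp _ hT
    exact hm.hasDerivAt_eq_zero hline
  obtain ⟨Λ, hΛ⟩ : (D : V →ₗ[ℝ] ℝ) ∈ LinearMap.range T.linear.dualMap := by
    rw [LinearMap.range_dualMap_eq_dualAnnihilator_ker, Submodule.mem_dualAnnihilator]
    exact fun v hv => LinearMap.mem_ker.1 (hker hv)
  refine ⟨α, -Λ, hα, fun y => ?_⟩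
  have h1 := convexOn_add_fderiv_le hΦc (hΦd x).hasFDerivAt y
  have h2 : D (y - x) = Λ (T y) := by
    have h3 := congrArg (fun L => L (y - x)) hΛ
    have h4 := T.linearMap_vsub y x
    simp only [vsub_eq_sub] at h4
    simp only [LinearMap.dualMap_apply, h4, hx, sub_zero] at h3
    exact h3.symm
  have h5 : Φ x + D (y - x) ≤ Φ y := h1
  rw [h2, hΦx] at h5
  simp only [LinearMap.neg_apply]
  simp only [hΦ] at h5
  linarith

/-! ### The consensus operator and the Lagrangian -/

variable {N m n : ℕ}

/-- The consensus operator `x ↦ -𝐋 x`; the block of agent `i` is `∑ⱼ aᵢⱼ (xⱼ - xᵢ)`. -/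
def diffusion (a : Matrix (Fin N) (Fin N) ℝ) (x : Fin N → E n) (i : Fin N) : E n :=
  ∑ j, a i j • (x j - x i)

theorem lapl_eq_neg_diffusion (a : Matrix (Fin N) (Fin N) ℝ) (x : Fin N → E n) :
    lapl a x = -diffusion a x := by
  funext i
  simp only [lapl, laplacian, diffusion, Pi.neg_apply, Matrix.sub_apply, sub_smul, smul_sub,
    Finset.sum_sub_distrib, Matrix.diagonal_apply, ite_smul, zero_smul, Finset.sum_ite_eq,
    Finset.mem_univ, if_true, ← Finset.sum_smul, Matrix.mulVec, dotProduct, Pi.one_apply, mul_one]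
  abel

theorem sum_inner_diffusion {a : Matrix (Fin N) (Fin N) ℝ} (ha : ∀ i j, a i j = a j i)
    (y x : Fin N → E n) :
    ∑ i, inner ℝ (y i) (diffusion a x i)
      = -(1 / 2) * ∑ i, ∑ j, a i j * inner ℝ (y j - y i) (x j - x i) := by
  have h1 : ∑ i, inner ℝ (y i) (diffusion a x i)
      = ∑ i, ∑ j, a i j * inner ℝ (y i) (x j - x i) := by
    simp only [diffusion, inner_sum, inner_smul_right]
  have h2 : ∑ i, ∑ j, a i j * inner ℝ (y i) (x j - x i)
      = ∑ i, ∑ j, a i j * inner ℝ (y j) (x i - x j) := by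
    rw [Finset.sum_comm]
    simp only [ha]
  have h3 : ∑ i, ∑ j, a i j * inner ℝ (y j - y i) (x j - x i)
      = -(∑ i, ∑ j, a i j * inner ℝ (y j) (x i - x j))
        - ∑ i, ∑ j, a i j * inner ℝ (y i) (x j - x i) := by
    simp only [← Finset.sum_neg_distrib, ← Finset.sum_sub_distrib]
    refine Finset.sum_congr rfl fun i _ => Finset.sum_congr rfl fun j _ => ?_
    rw [inner_sub_left, ← neg_sub (x j) (x i), inner_neg_right]
    ring
  rw [h3, ← h2, h1]; ring

theorem sum_inner_diffusion_comm {a : Matrix (Fin N) (Fin N) ℝ} (ha : ∀ i j, a i j = a j i)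
    (y x : Fin N → E n) :
    ∑ i, inner ℝ (y i) (diffusion a x i) = ∑ i, inner ℝ (x i) (diffusion a y i) := by
  rw [sum_inner_diffusion ha, sum_inner_diffusion ha]
  simp only [real_inner_comm]

/-- The disagreement `xᵀ 𝐋 x = (1/2) ∑ᵢⱼ aᵢⱼ ‖xⱼ - xᵢ‖²`. -/
noncomputable def disagreement (a : Matrix (Fin N) (Fin N) ℝ) (x : Fin N → E n) : ℝ :=
  (1 / 2) * ∑ i, ∑ j, a i j * ‖x j - x i‖ ^ 2

theorem sum_inner_diffusion_self {a : Matrix (Fin N) (Fin N) ℝ} (ha : ∀ i j, a i j = a j i)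
    (x : Fin N → E n) : ∑ i, inner ℝ (x i) (diffusion a x i) = -disagreement a x := by
  rw [sum_inner_diffusion ha]
  simp only [real_inner_self_eq_norm_sq, disagreement]
  ring

theorem IsWeightedAdjacency.nonneg {G : SimpleGraph (Fin N)} {a : Matrix (Fin N) (Fin N) ℝ}
    (ha : IsWeightedAdjacency G a) (i j : Fin N) : 0 ≤ a i j := by
  by_cases h : G.Adj i j
  · exact (ha.pos i j h).le
  · exact (ha.zero i j h).ge

theorem disagreement_nonneg {a : Matrix (Fin N) (Fin N) ℝ} (ha : ∀ i j, 0 ≤ a i j)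
    (x : Fin N → E n) : 0 ≤ disagreement a x := by
  have : ∀ i j, 0 ≤ a i j * ‖x j - x i‖ ^ 2 := fun i j => mul_nonneg (ha i j) (by positivity)
  exact mul_nonneg (by norm_num)
    (Finset.sum_nonneg fun i _ => Finset.sum_nonneg fun j _ => this i j)

theorem mul_norm_sq_le_disagreement {a : Matrix (Fin N) (Fin N) ℝ} (ha : ∀ i j, 0 ≤ a i j)
    (x : Fin N → E n) (i j : Fin N) : a i j * ‖x j - x i‖ ^ 2 ≤ 2 * disagreement a x := by
  have h0 : ∀ i j, 0 ≤ a i j * ‖x j - x i‖ ^ 2 := fun i j => mul_nonneg (ha i j) (by positivity)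
  have h1 := Finset.single_le_sum (f := fun j => a i j * ‖x j - x i‖ ^ 2)
    (fun j _ => h0 i j) (Finset.mem_univ j)
  have h2 := Finset.single_le_sum (f := fun i => ∑ j, a i j * ‖x j - x i‖ ^ 2)
    (fun i _ => Finset.sum_nonneg fun j _ => h0 i j) (Finset.mem_univ i)
  beta_reduce at h1 h2
  unfold disagreement
  linarith

theorem diffusion_eq_zero_of_disagreement {a : Matrix (Fin N) (Fin N) ℝ} (ha : ∀ i j, 0 ≤ a i j)
    {x : Fin N → E n} (hx : disagreement a x ≤ 0) : diffusion a x = 0 := by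
  funext i
  refine Finset.sum_eq_zero fun j _ => ?_
  have h := mul_norm_sq_le_disagreement ha x i j
  rcases (ha i j).eq_or_lt with h0 | h0
  · simp [← h0]
  · have : ‖x j - x i‖ ^ 2 ≤ 0 := by
      by_contra! hc
      have := mul_pos h0 hc
      linarith
    have : ‖x j - x i‖ = 0 := by nlinarith [norm_nonneg (x j - x i)]
    simp [norm_eq_zero.1 this]

/-- On a connected graph the kernel of the Laplacian consists of the consensus vectors. -/
theorem eq_of_diffusion_eq_zero {G : SimpleGraph (Fin N)} (hG : G.Connected)
    {a : Matrix (Fin N) (Fin N) ℝ} (ha : IsWeightedAdjacency G a) {x : Fin N → E n}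
    (hx : diffusion a x = 0) (i j : Fin N) : x i = x j := by
  have hd : disagreement a x = 0 := by
    have := sum_inner_diffusion_self ha.symm x
    simp only [hx, Pi.zero_apply, inner_zero_right, Finset.sum_const_zero] at this
    linarith
  have hadj : ∀ i j, G.Adj i j → x i = x j := by
    intro i j h
    have h1 := mul_norm_sq_le_disagreement ha.nonneg x i j
    rw [hd, mul_zero] at h1
    have h2 : ‖x j - x i‖ ^ 2 ≤ 0 := by
      by_contra! hc
      have := mul_pos (ha.pos i j h) hc
      linarith
    have h3 : ‖x j - x i‖ = 0 := by nlinarith [norm_nonneg (x j - x i)]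
    exact (sub_eq_zero.1 (norm_eq_zero.1 h3)).symm
  obtain ⟨p⟩ := hG.preconnected i j
  induction p with
  | nil => rfl
  | cons h _ ih => exact (hadj _ _ h).trans ih

/-- The Lagrangian of the consensus reformulation, with multiplier `λᵢ²` for `gᵢ ≤ 0`. -/
noncomputable def lagrangian (P : Problem N n) (a : Matrix (Fin N) (Fin N) ℝ)
    (x ξ : Fin N → E n) (lam μ : Fin N → ℝ) : ℝ :=
  ∑ i, (P.f i (x i) + lam i ^ 2 * P.g i (x i) + μ i * P.h i (x i)
    + inner ℝ (x i) (diffusion a ξ i))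

/-- At a point that satisfies the equality constraints only the inequality constraints
contribute to the Lagrangian. -/
theorem lagrangian_of_diffusion_eq_zero (P : Problem N n) {a : Matrix (Fin N) (Fin N) ℝ}
    (ha : ∀ i j, a i j = a j i) {x : Fin N → E n} (hx : diffusion a x = 0)
    (hh : ∀ i, P.h i (x i) = 0) (ξ : Fin N → E n) (lam μ : Fin N → ℝ) :
    lagrangian P a x ξ lam μ = ∑ i, P.f i (x i) + ∑ i, lam i ^ 2 * P.g i (x i) := by
  simp only [lagrangian, Finset.sum_add_distrib, hh, mul_zero, add_zero]
  rw [sum_inner_diffusion_comm ha, hx]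
  simp

/-- A linear functional on the space of equality constraint values `(v, w)` is given by
a multiplier `μ` for `v` and a multiplier `ξ` for `w`. -/
theorem exists_dual_representation (Λ : (Fin N → ℝ) × (Fin N → E n) →ₗ[ℝ] ℝ) :
    ∃ (μ : Fin N → ℝ) (ξ : Fin N → E n), ∀ v w,
      Λ (v, w) = ∑ i, μ i * v i + ∑ i, inner ℝ (ξ i) (w i) := by
  classical
  refine ⟨fun i => Λ (Pi.single i 1, 0), fun i => (InnerProductSpace.toDual ℝ (E n)).symm
    (LinearMap.toContinuousLinearMap
      (Λ ∘ₗ LinearMap.inr ℝ _ _ ∘ₗ LinearMap.single ℝ (fun _ => E n) i)), fun v w => ?_⟩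
  have h1 : Λ (v, w) = Λ (v, 0) + Λ (0, w) := by rw [← map_add]; simp
  have h2 : (v, (0 : Fin N → E n)) = ∑ i, v i • ((Pi.single i 1 : Fin N → ℝ), 0) := by
    ext1
    · funext k; simp [Prod.fst_sum, Finset.sum_apply, Pi.single_apply]
    · simp [Prod.snd_sum]
  have h3 : ((0 : Fin N → ℝ), w) = ∑ i, ((0 : Fin N → ℝ), (Pi.single i (w i) : Fin N → E n)) := by
    ext1
    · simp [Prod.fst_sum]
    · rw [Prod.snd_sum]; exact (Finset.univ_sum_single w).symm
  rw [h1, h2, h3, map_sum, map_sum]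
  congr 1
  · exact Finset.sum_congr rfl fun i _ => by rw [map_smul, smul_eq_mul, mul_comm]
  · exact Finset.sum_congr rfl fun i _ => by simp

/-- Strong duality for the consensus reformulation, in which the consensus constraint `𝐋 x = 0`
is one of the affine equality constraints and has the multiplier `ξ`. -/
theorem exists_dual_optimal (P : Problem N n)
    (hf : ∀ i, ConvexOn ℝ univ (P.f i)) (hfd : ∀ i, Differentiable ℝ (P.f i))
    (hg : ∀ i, ConvexOn ℝ univ (P.g i)) (hgd : ∀ i, Differentiable ℝ (P.g i))
    (hSlater : P.Slater) {G : SimpleGraph (Fin N)} (hG : G.Connected)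
    {a : Matrix (Fin N) (Fin N) ℝ} (ha : IsWeightedAdjacency G a) {z : E n} (hz : P.IsOptimal z) :
    ∃ (ξ : Fin N → E n) (lam μ : Fin N → ℝ), (∀ i, 0 ≤ lam i) ∧
      ∀ y, ∑ i, P.f i z ≤ lagrangian P a y ξ lam μ := by
  classical
  obtain ⟨z₀, hz₀⟩ := hSlater
  let S : (Fin N → E n) →ₗ[ℝ] (Fin N → E n) :=
    LinearMap.pi fun i => ∑ j, a i j • (LinearMap.proj (R := ℝ) (φ := fun _ : Fin N => E n) j -
      LinearMap.proj (R := ℝ) (φ := fun _ : Fin N => E n) i)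
  have hS : ∀ y, S y = diffusion a y := fun y => by
    funext i; simp [S, diffusion, LinearMap.sum_apply]
  let T : (Fin N → E n) →ᵃ[ℝ] (Fin N → ℝ) × (Fin N → E n) :=
    (AffineMap.pi fun i => (P.h i).comp
      (LinearMap.proj (R := ℝ) (φ := fun _ : Fin N => E n) i).toAffineMap).prod S.toAffineMap
  have hT : ∀ y, T y = (fun i => P.h i (y i), diffusion a y) := fun y => by
    rw [← hS]; rfl
  have hconst : ∀ w : E n, diffusion a (fun _ => w) = 0 := fun w => by
    funext i; simp [diffusion]
  have hcomp : ∀ i : Fin N, ∀ φ : E n → ℝ, ConvexOn ℝ univ φ →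
      ConvexOn ℝ univ (fun y : Fin N → E n => φ (y i)) := fun i φ h => by
    exact h.comp_linearMap (LinearMap.proj (R := ℝ) (φ := fun _ : Fin N => E n) i)
  obtain ⟨α, Λ, hα, hΛ⟩ := exists_multipliers (V := Fin N → E n)
    (φ := fun y => ∑ i, P.f i (y i)) (ψ := fun i y => P.g i (y i))
    ⟨convex_univ, fun u _ v _ s r hs hr hsr => by
      simp only [Finset.smul_sum, ← Finset.sum_add_distrib]
      exact Finset.sum_le_sum fun i _ =>
        (hcomp i _ (hf i)).2 (mem_univ u) (mem_univ v) hs hr hsr⟩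
    (Differentiable.fun_sum fun i _ => (hfd i).comp (by fun_prop))
    (fun i => hcomp i _ (hg i)) (fun i => (hgd i).comp (by fun_prop)) T
    (z := fun _ => z₀) (by rw [hT, hconst]; ext1; exacts [funext fun i => (hz₀ i).2, rfl])
    (fun i => (hz₀ i).1)
    (x := fun _ => z) (by rw [hT, hconst]; ext1; exacts [funext fun i => (hz.1 i).2, rfl])
    (fun i => (hz.1 i).1)
    (fun y hy hyg => by
      rw [hT, Prod.mk_eq_zero] at hy
      have i₀ : Fin N := hG.nonempty.some
      have hyc : ∀ i, y i = y i₀ := fun i => eq_of_diffusion_eq_zero hG ha hy.2 i i₀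
      simp only [hyc]
      exact hz.2 _ fun i => by
        rw [← hyc i]
        exact ⟨hyg i, congrFun hy.1 i⟩)
  obtain ⟨μ, ξ, hμξ⟩ := exists_dual_representation Λ
  refine ⟨ξ, fun i => √(α i), μ, fun i => Real.sqrt_nonneg _, fun y => ?_⟩
  have h := hΛ y
  rw [hT, hμξ, sum_inner_diffusion_comm ha.symm] at h
  simp only [lagrangian, Finset.sum_add_distrib, Real.sq_sqrt (hα _)]
  linarith

/-! ### The Lyapunov function -/

theorem exists_hasGradientAt_affine (h : E n →ᵃ[ℝ] ℝ) : ∃ v, ∀ x, HasGradientAt h v x := by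
  refine ⟨(InnerProductSpace.toDual ℝ (E n)).symm (LinearMap.toContinuousLinearMap h.linear),
    fun x => ?_⟩
  have : (h : E n → ℝ) = fun y => LinearMap.toContinuousLinearMap h.linear y + h 0 := by
    conv_lhs => rw [h.decomp]
    rfl
  rw [hasGradientAt_iff_hasFDerivAt, LinearIsometryEquiv.apply_symm_apply, this]
  exact (ContinuousLinearMap.hasFDerivAt _).add_const _

theorem affine_eq_add_inner_gradient (h : E n →ᵃ[ℝ] ℝ) (x y : E n) :
    h y = h x + inner ℝ (gradient h x) (y - x) := by
  obtain ⟨v, hv⟩ := exists_hasGradientAt_affine h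
  have hd : Differentiable ℝ h := fun x => (hv x).differentiableAt
  have h1 : h y = h x + h.linear (y - x) := by
    have := h.linearMap_vsub y x
    simp only [vsub_eq_sub] at this
    rw [this]; ring
  have h2 : ConvexOn ℝ univ h := ⟨convex_univ, fun u _ v _ s r _ _ hsr => by
    rw [Convex.combo_affine_apply hsr]⟩
  refine le_antisymm ?_ (convexOn_add_inner_gradient_le h2 hd x y)
  have h4 := convexOn_add_inner_gradient_le h2 hd x (x - (y - x))
  have h5 := h.linearMap_vsub (x - (y - x)) x
  simp only [vsub_eq_sub, sub_sub_cancel_left, map_neg, inner_neg_right] at h4 h5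
  linarith

theorem TwiceDifferentiable.continuous_gradient {φ : E n → ℝ} (h : TwiceDifferentiable φ) :
    Continuous (gradient φ) :=
  (InnerProductSpace.toDual ℝ (E n)).symm.continuous.comp h.2.continuous

theorem continuous_gradient_affine (h : E n →ᵃ[ℝ] ℝ) : Continuous (gradient h) := by
  obtain ⟨v, hv⟩ := exists_hasGradientAt_affine h
  rw [gradient_eq hv]
  exact continuous_const

theorem continuous_affine (h : E n →ᵃ[ℝ] ℝ) : Continuous h := by
  obtain ⟨v, hv⟩ := exists_hasGradientAt_affine h
  exact continuous_iff_continuousAt.2 fun x => (hv x).differentiableAt.continuousAt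

/-- The part of the Lyapunov function that belongs to a variable `λ` with reference value `l`:
up to the factor `1/4`, the generalized Kullback–Leibler divergence
`l² log (l² / λ²) - l² + λ²`. It is written with separate logarithms so that it is
`λ² / 4` for `l = 0` (there the logarithms have coefficient `0`). -/
noncomputable def barrier (l y : ℝ) : ℝ :=
  (y ^ 2 - l ^ 2) / 4 - l ^ 2 / 2 * (Real.log y - Real.log l)

theorem barrier_self (l : ℝ) : barrier l l = 0 := by simp [barrier]

theorem le_barrier {l y : ℝ} (hl : 0 ≤ l) (hy : 0 < y) : (y - l) ^ 2 / 4 ≤ barrier l y := by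
  rcases hl.eq_or_lt with rfl | hl
  · simp [barrier]
  · have h := Real.log_le_sub_one_of_pos (div_pos hy hl)
    rw [Real.log_div hy.ne' hl.ne'] at h
    have h2 : l ^ 2 / 2 * (Real.log y - Real.log l) ≤ l ^ 2 / 2 * (y / l - 1) := by gcongr
    have h3 : l ^ 2 / 2 * (y / l - 1) = l * (y - l) / 2 := by field_simp
    unfold barrier
    nlinarith

theorem barrier_nonneg {l y : ℝ} (hl : 0 ≤ l) (hy : 0 < y) : 0 ≤ barrier l y :=
  le_trans (by positivity) (le_barrier hl hy)

theorem continuousAt_barrier_self (l : ℝ) : ContinuousAt (barrier l) l := by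
  unfold barrier
  by_cases hl : l = 0
  · subst hl
    simp only [ne_eq, OfNat.ofNat_ne_zero, not_false_eq_true, zero_pow, zero_div, zero_mul,
      sub_zero]
    fun_prop
  · have : ContinuousAt Real.log l := Real.continuousAt_log hl
    fun_prop

/-- The barrier keeps `λ` away from `0` if the reference value is positive. -/
theorem exists_pos_le_of_barrier_le {l : ℝ} (hl : 0 < l) (C : ℝ) :
    ∃ δ > 0, ∀ y, 0 < y → barrier l y ≤ C → δ ≤ y := by
  refine ⟨Real.exp (Real.log l - (C + l ^ 2 / 4) / (l ^ 2 / 2)), Real.exp_pos _, fun y hy h => ?_⟩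
  rw [← Real.le_log_iff_exp_le hy, sub_le_comm, le_div_iff₀ (by positivity)]
  unfold barrier at h
  nlinarith

theorem hasDerivWithinAt_barrier {u : ℝ → ℝ} {l g t : ℝ} {s : Set ℝ} (hpos : 0 < u t)
    (hu : HasDerivWithinAt u (2 * u t * g) s t) :
    HasDerivWithinAt (fun r => barrier l (u r)) ((u t ^ 2 - l ^ 2) * g) s t := by
  have h := (((hu.pow 2).sub_const (l ^ 2)).div_const 4).sub
    (((hu.log hpos.ne').sub_const (Real.log l)).const_mul (l ^ 2 / 2))
  refine (h.congr_deriv ?_)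
  have := hpos.ne'
  field_simp
  ring

/-- The Lyapunov function of the state `s` relative to the reference state `e`. -/
noncomputable def lyapunov (c : Fin N → Fin m → ℝ) (e s : State N m n) : ℝ :=
  ∑ i, (∑ k, (2 * c i k)⁻¹ * ‖s.rho i k - e.rho i k‖ ^ 2 + ‖s.xi i - e.xi i‖ ^ 2 / 2
    + (s.mu i - e.mu i) ^ 2 / 2 + barrier (e.lam i) (s.lam i))

/-- A quadratic lower bound of the Lyapunov function, continuous also where some `λᵢ = 0`. -/
noncomputable def gap (c : Fin N → Fin m → ℝ) (e s : State N m n) : ℝ :=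
  ∑ i, (∑ k, (2 * c i k)⁻¹ * ‖s.rho i k - e.rho i k‖ ^ 2 + ‖s.xi i - e.xi i‖ ^ 2 / 2
    + (s.mu i - e.mu i) ^ 2 / 2 + (s.lam i - e.lam i) ^ 2 / 4)

/-- The derivative of the Lyapunov function along the algorithm. -/
noncomputable def lyapunovRate (P : Problem N n) (a : Matrix (Fin N) (Fin N) ℝ)
    (b c : Fin N → Fin m → ℝ) (e s : State N m n) : ℝ :=
  ∑ i, (∑ k, (c i k)⁻¹ * inner ℝ (s.rho i k - e.rho i k)
      (-(b i k • s.rho i k) + c i k • nu P a s i)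
    + inner ℝ (s.xi i - e.xi i) (diffusion a s.x i)
    + (s.mu i - e.mu i) * P.h i (s.x i) + (s.lam i ^ 2 - e.lam i ^ 2) * P.g i (s.x i))

/-- The energy lost in the compensators and through disagreement. -/
noncomputable def dissipation (a : Matrix (Fin N) (Fin N) ℝ) (b c : Fin N → Fin m → ℝ)
    (s : State N m n) : ℝ :=
  ∑ i, ∑ k, (c i k)⁻¹ * b i k * ‖s.rho i k‖ ^ 2 + disagreement a s.x

/-- Reference states for which the Lyapunov function is useful. Neither `gᵢ(xᵢ) ≤ 0` nor
complementary slackness is part of the definition, and the multipliers need not belong to the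
same equilibrium as `x`; only the value of the dual function is compared with that of `x`. -/
structure IsAnchor (P : Problem N n) (a : Matrix (Fin N) (Fin N) ℝ) (b : Fin N → Fin m → ℝ)
    (e : State N m n) : Prop where
  rest : ∀ i k, b i k • e.rho i k = 0
  consensus : diffusion a e.x = 0
  eq_zero : ∀ i, P.h i (e.x i) = 0
  lam_nonneg : ∀ i, 0 ≤ e.lam i
  dual : ∀ y, ∑ i, P.f i (e.x i) ≤ lagrangian P a y e.xi e.lam e.mu

theorem nu_eq (P : Problem N n) (a : Matrix (Fin N) (Fin N) ℝ) (s : State N m n) (i : Fin N) :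
    nu P a s i = - gradient (P.f i) (s.x i) - s.lam i ^ 2 • gradient (P.g i) (s.x i)
      - s.mu i • gradient (P.h i) (s.x i) + diffusion a s.x i - diffusion a s.xi i := rfl

/-- The dissipation inequality. Convexity turns the gradients in `ν` into differences of the
Lagrangian, and the coupling terms cancel since the consensus operator is symmetric. -/
theorem lyapunovRate_le {P : Problem N n}
    (hf : ∀ i, ConvexOn ℝ univ (P.f i)) (hfd : ∀ i, Differentiable ℝ (P.f i))
    (hg : ∀ i, ConvexOn ℝ univ (P.g i)) (hgd : ∀ i, Differentiable ℝ (P.g i))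
    {a : Matrix (Fin N) (Fin N) ℝ} (ha : ∀ i j, a i j = a j i) {b c : Fin N → Fin m → ℝ}
    (hc : ∀ i k, 0 < c i k) {e : State N m n} (he : IsAnchor P a b e) (s : State N m n) :
    lyapunovRate P a b c e s
      ≤ -dissipation a b c s + ∑ i, s.lam i ^ 2 * P.g i (e.x i) := by
  have hrho : ∀ i, ∑ k, (c i k)⁻¹ * inner ℝ (s.rho i k - e.rho i k)
        (-(b i k • s.rho i k) + c i k • nu P a s i)
      = -(∑ k, (c i k)⁻¹ * b i k * ‖s.rho i k‖ ^ 2)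
        + inner ℝ (s.x i - e.x i) (nu P a s i) := by
    intro i
    have hx : s.x i - e.x i = ∑ k, (s.rho i k - e.rho i k) := by
      simp [State.x, Finset.sum_sub_distrib]
    rw [hx, sum_inner, ← Finset.sum_neg_distrib, ← Finset.sum_add_distrib]
    refine Finset.sum_congr rfl fun k _ => ?_
    have h0 : b i k * inner ℝ (e.rho i k) (s.rho i k) = 0 := by
      rw [← real_inner_smul_left, he.rest, inner_zero_left]
    have hck := (hc i k).ne'
    rw [inner_add_right, inner_neg_right, real_inner_smul_right, real_inner_smul_right,
      inner_sub_left _ _ (s.rho i k), real_inner_self_eq_norm_sq, mul_sub, h0]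
    field_simp
    ring
  have hagent : ∀ i, inner ℝ (s.x i - e.x i) (nu P a s i)
        + inner ℝ (s.xi i - e.xi i) (diffusion a s.x i)
        + (s.mu i - e.mu i) * P.h i (s.x i) + (s.lam i ^ 2 - e.lam i ^ 2) * P.g i (s.x i)
      ≤ P.f i (e.x i) + s.lam i ^ 2 * P.g i (e.x i)
        - (P.f i (s.x i) + e.lam i ^ 2 * P.g i (s.x i) + e.mu i * P.h i (s.x i)
          + inner ℝ (s.x i) (diffusion a e.xi i))
        + (inner ℝ (s.x i) (diffusion a s.x i) - inner ℝ (e.x i) (diffusion a s.x i)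
          - inner ℝ (s.x i) (diffusion a s.xi i) + inner ℝ (e.x i) (diffusion a s.xi i)
          + inner ℝ (s.xi i) (diffusion a s.x i) - inner ℝ (e.xi i) (diffusion a s.x i)
          + inner ℝ (s.x i) (diffusion a e.xi i)) := by
    intro i
    have h1 := convexOn_add_inner_gradient_le (hf i) (hfd i) (s.x i) (e.x i)
    have h2 := mul_le_mul_of_nonneg_left
      (convexOn_add_inner_gradient_le (hg i) (hgd i) (s.x i) (e.x i)) (sq_nonneg (s.lam i))
    have h3 := affine_eq_add_inner_gradient (P.h i) (s.x i) (e.x i)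
    rw [he.eq_zero] at h3
    have hsw : ∀ v : E n, inner ℝ v (e.x i - s.x i) = - inner ℝ (s.x i - e.x i) v := by
      intro v; rw [← neg_sub, inner_neg_right, real_inner_comm]
    rw [hsw] at h1 h2 h3
    have h4 : s.mu i * inner ℝ (s.x i - e.x i) (gradient (P.h i) (s.x i))
        = s.mu i * P.h i (s.x i) := by
      congr 1; linarith
    rw [nu_eq]
    simp only [inner_add_right, inner_sub_right, inner_neg_right, real_inner_smul_right] at h1 h2 ⊢
    rw [h4]
    simp only [inner_sub_left] at h1 h2 ⊢
    linarith
  have hsum := Finset.sum_le_sum fun i (_ : i ∈ Finset.univ) => hagent i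
  have hdual := he.dual s.x
  have hzero : ∀ y, ∑ i, inner ℝ (e.x i) (diffusion a y i) = 0 := fun y => by
    rw [sum_inner_diffusion_comm ha, he.consensus]; simp
  have hself := sum_inner_diffusion_self ha s.x
  have hc1 := sum_inner_diffusion_comm ha s.x s.xi
  have hc2 := sum_inner_diffusion_comm ha s.x e.xi
  have hz1 := hzero s.x
  have hz2 := hzero s.xi
  simp only [lagrangian] at hdual
  simp only [lyapunovRate, dissipation, hrho]
  simp only [Finset.sum_add_distrib, Finset.sum_sub_distrib, Finset.sum_neg_distrib] at hsum hdual ⊢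
  linarith

/-! ### Continuity of the algorithm's right-hand side -/

theorem continuous_state_x (i : Fin N) : Continuous fun s : State N m n => s.x i := by
  unfold State.x State.rho
  fun_prop

theorem continuous_rho (i : Fin N) (k : Fin m) : Continuous fun s : State N m n => s.rho i k := by
  unfold State.rho; fun_prop

theorem continuous_xi (i : Fin N) : Continuous fun s : State N m n => s.xi i := by
  unfold State.xi; fun_prop

theorem continuous_lam (i : Fin N) : Continuous fun s : State N m n => s.lam i := by
  unfold State.lam; fun_prop

theorem continuous_mu (i : Fin N) : Continuous fun s : State N m n => s.mu i := by
  unfold State.mu; fun_prop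

theorem continuous_diffusion_x (a : Matrix (Fin N) (Fin N) ℝ) (i : Fin N) :
    Continuous fun s : State N m n => diffusion a s.x i := by
  have := continuous_state_x (N := N) (m := m) (n := n)
  unfold diffusion; fun_prop

theorem continuous_diffusion_xi (a : Matrix (Fin N) (Fin N) ℝ) (i : Fin N) :
    Continuous fun s : State N m n => diffusion a s.xi i := by
  have := continuous_xi (N := N) (m := m) (n := n)
  unfold diffusion; fun_prop

theorem continuous_nu {P : Problem N n} (hf : ∀ i, TwiceDifferentiable (P.f i))
    (hg : ∀ i, TwiceDifferentiable (P.g i)) (a : Matrix (Fin N) (Fin N) ℝ) (i : Fin N) :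
    Continuous fun s : State N m n => nu P a s i := by
  simp only [nu_eq]
  have h1 := (hf i).continuous_gradient.comp (continuous_state_x (m := m) i)
  have h2 := (hg i).continuous_gradient.comp (continuous_state_x (m := m) i)
  have h3 := (continuous_gradient_affine (P.h i)).comp (continuous_state_x (m := m) i)
  exact ((((h1.neg).sub (((continuous_lam i).pow 2).smul h2)).sub
    ((continuous_mu i).smul h3)).add (continuous_diffusion_x a i)).sub (continuous_diffusion_xi a i)

theorem continuous_field {P : Problem N n} (hf : ∀ i, TwiceDifferentiable (P.f i))
    (hg : ∀ i, TwiceDifferentiable (P.g i)) (a : Matrix (Fin N) (Fin N) ℝ)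
    (b c : Fin N → Fin m → ℝ) : Continuous (field P a b c) := by
  refine Continuous.prodMk ?_ (Continuous.prodMk ?_ (Continuous.prodMk ?_ ?_))
  · refine continuous_pi fun i => continuous_pi fun k => ?_
    exact ((continuous_rho i k).const_smul (b i k)).neg.add
      ((continuous_nu hf hg a i).const_smul (c i k))
  · exact continuous_pi fun i => continuous_diffusion_x a i
  · refine continuous_pi fun i => ?_
    exact ((continuous_lam i).const_mul 2).mul
      ((hg i).1.continuous.comp (continuous_state_x (m := m) i))
  · exact continuous_pi fun i => (continuous_affine (P.h i)).comp (continuous_state_x (m := m) i)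

theorem continuous_lyapunovRate {P : Problem N n} (hf : ∀ i, TwiceDifferentiable (P.f i))
    (hg : ∀ i, TwiceDifferentiable (P.g i)) (a : Matrix (Fin N) (Fin N) ℝ)
    (b c : Fin N → Fin m → ℝ) (e : State N m n) : Continuous (lyapunovRate P a b c e) := by
  have h1 := continuous_rho (N := N) (m := m) (n := n)
  have h2 := continuous_xi (N := N) (m := m) (n := n)
  have h3 := continuous_lam (N := N) (m := m) (n := n)
  have h4 := continuous_mu (N := N) (m := m) (n := n)
  have h5 := fun i => continuous_nu (m := m) hf hg a i
  have h6 := continuous_diffusion_x (N := N) (m := m) (n := n) a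
  have h7 := fun i => (hg i).1.continuous.comp (continuous_state_x (m := m) i)
  have h8 := fun i => (continuous_affine (P.h i)).comp (continuous_state_x (m := m) i)
  simp only [Function.comp_def] at h7 h8
  unfold lyapunovRate
  fun_prop

theorem continuous_gap (c : Fin N → Fin m → ℝ) (e : State N m n) : Continuous (gap c e) := by
  have h1 := continuous_rho (N := N) (m := m) (n := n)
  have h2 := continuous_xi (N := N) (m := m) (n := n)
  have h3 := continuous_lam (N := N) (m := m) (n := n)
  have h4 := continuous_mu (N := N) (m := m) (n := n)
  unfold gap
  fun_prop

/-- The Lyapunov function is continuous at every state that has the reference's `λ`, even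
where some `λᵢ` vanishes. -/
theorem continuousAt_lyapunov (c : Fin N → Fin m → ℝ) {e s : State N m n}
    (h : s.lam = e.lam) : ContinuousAt (lyapunov c e) s := by
  have h1 := continuous_rho (N := N) (m := m) (n := n)
  have h2 := continuous_xi (N := N) (m := m) (n := n)
  have h4 := continuous_mu (N := N) (m := m) (n := n)
  have h3 : ∀ i, ContinuousAt (fun s : State N m n => barrier (e.lam i) (s.lam i)) s := fun i => by
    have hb := continuousAt_barrier_self (e.lam i)
    rw [← h] at hb ⊢
    exact ContinuousAt.comp (g := barrier (s.lam i)) hb (continuous_lam i).continuousAt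
  unfold lyapunov
  fun_prop

theorem gap_le_lyapunov (c : Fin N → Fin m → ℝ) {e s : State N m n} (he : ∀ i, 0 ≤ e.lam i)
    (hs : ∀ i, 0 < s.lam i) : gap c e s ≤ lyapunov c e s :=
  Finset.sum_le_sum fun i _ => by
    have := le_barrier (he i) (hs i)
    linarith

theorem gap_nonneg {c : Fin N → Fin m → ℝ} (hc : ∀ i k, 0 < c i k) (e s : State N m n) :
    0 ≤ gap c e s := by
  refine Finset.sum_nonneg fun i _ => ?_
  have : 0 ≤ ∑ k, (2 * c i k)⁻¹ * ‖s.rho i k - e.rho i k‖ ^ 2 :=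
    Finset.sum_nonneg fun k _ => mul_nonneg (by have := hc i k; positivity) (by positivity)
  positivity

theorem dissipation_nonneg {a : Matrix (Fin N) (Fin N) ℝ} (ha : ∀ i j, 0 ≤ a i j)
    {b c : Fin N → Fin m → ℝ} (hb : ∀ i k, 0 ≤ b i k) (hc : ∀ i k, 0 < c i k)
    (s : State N m n) : 0 ≤ dissipation a b c s := by
  refine add_nonneg (Finset.sum_nonneg fun i _ => Finset.sum_nonneg fun k _ => ?_)
    (disagreement_nonneg ha _)
  have := hc i k
  have := hb i k
  positivity

theorem barrier_le_lyapunov {c : Fin N → Fin m → ℝ} (hc : ∀ i k, 0 < c i k) {e s : State N m n}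
    (he : ∀ i, 0 ≤ e.lam i) (hs : ∀ i, 0 < s.lam i) (i : Fin N) :
    barrier (e.lam i) (s.lam i) ≤ lyapunov c e s := by
  have hk : ∀ i, 0 ≤ ∑ k, (2 * c i k)⁻¹ * ‖s.rho i k - e.rho i k‖ ^ 2 := fun i =>
    Finset.sum_nonneg fun k _ => mul_nonneg (by have := hc i k; positivity) (by positivity)
  have hi : ∀ i, 0 ≤ ∑ k, (2 * c i k)⁻¹ * ‖s.rho i k - e.rho i k‖ ^ 2 + ‖s.xi i - e.xi i‖ ^ 2 / 2
      + (s.mu i - e.mu i) ^ 2 / 2 := fun i => by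
    have := hk i
    positivity
  have hb := fun i => barrier_nonneg (he i) (hs i)
  refine le_trans ?_ (Finset.single_le_sum (fun i _ => add_nonneg (hi i) (hb i))
    (Finset.mem_univ i))
  linarith [hi i]

/-- The quadratic gap dominates the square of the distance to the reference state. -/
theorem exists_norm_sq_le_gap {c : Fin N → Fin m → ℝ} (hc : ∀ i k, 0 < c i k) :
    ∃ K > 0, ∀ e s : State N m n, ‖s - e‖ ^ 2 ≤ K * gap c e s := by
  have hcs : ∀ i k, c i k ≤ ∑ i, ∑ k, c i k := fun i k =>
    (Finset.single_le_sum (fun k _ => (hc i k).le) (Finset.mem_univ k)).trans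
      (Finset.single_le_sum (f := fun i => ∑ k, c i k)
        (fun i _ => Finset.sum_nonneg fun k _ => (hc i k).le) (Finset.mem_univ i))
  have hC : 0 ≤ ∑ i, ∑ k, c i k :=
    Finset.sum_nonneg fun i _ => Finset.sum_nonneg fun k _ => (hc i k).le
  set C := ∑ i, ∑ k, c i k
  refine ⟨4 + 2 * C, by positivity, fun e s => ?_⟩
  have hG := gap_nonneg hc e s
  have hkterm : ∀ i k, 0 ≤ (2 * c i k)⁻¹ * ‖s.rho i k - e.rho i k‖ ^ 2 := fun i k =>
    mul_nonneg (by have := hc i k; positivity) (by positivity)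
  have hksum : ∀ i, 0 ≤ ∑ k, (2 * c i k)⁻¹ * ‖s.rho i k - e.rho i k‖ ^ 2 := fun i =>
    Finset.sum_nonneg fun k _ => hkterm i k
  have hterm : ∀ i, ∑ k, (2 * c i k)⁻¹ * ‖s.rho i k - e.rho i k‖ ^ 2
      + ‖s.xi i - e.xi i‖ ^ 2 / 2 + (s.mu i - e.mu i) ^ 2 / 2
      + (s.lam i - e.lam i) ^ 2 / 4 ≤ gap c e s := fun i =>
    Finset.single_le_sum (f := fun i => ∑ k, (2 * c i k)⁻¹ * ‖s.rho i k - e.rho i k‖ ^ 2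
      + ‖s.xi i - e.xi i‖ ^ 2 / 2 + (s.mu i - e.mu i) ^ 2 / 2 + (s.lam i - e.lam i) ^ 2 / 4)
      (fun i _ => by have := hksum i; positivity) (Finset.mem_univ i)
  set B := (4 + 2 * C) * gap c e s with hBdef
  have hB : 0 ≤ B := by positivity
  have h4B : 4 * gap c e s ≤ B := by
    rw [hBdef]; nlinarith [mul_nonneg hC hG]
  have hrho : ∀ i k, ‖s.rho i k - e.rho i k‖ ≤ √B := fun i k => by
    refine Real.le_sqrt_of_sq_le ?_
    have h1 := (Finset.single_le_sum (fun k _ => hkterm i k) (Finset.mem_univ k)).trans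
      (le_trans (by have := sq_nonneg (s.mu i - e.mu i); have := sq_nonneg (s.lam i - e.lam i)
                    have := sq_nonneg ‖s.xi i - e.xi i‖; linarith) (hterm i))
    have h2 : ‖s.rho i k - e.rho i k‖ ^ 2
        = 2 * c i k * ((2 * c i k)⁻¹ * ‖s.rho i k - e.rho i k‖ ^ 2) := by
      have := (hc i k).ne'
      field_simp
    rw [h2]
    have h3 : 2 * c i k * ((2 * c i k)⁻¹ * ‖s.rho i k - e.rho i k‖ ^ 2)
        ≤ 2 * c i k * gap c e s :=
      mul_le_mul_of_nonneg_left h1 (by have := hc i k; positivity)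
    have h4 : c i k * gap c e s ≤ C * gap c e s := mul_le_mul_of_nonneg_right (hcs i k) hG
    rw [hBdef]; nlinarith
  have hxi : ∀ i, ‖s.xi i - e.xi i‖ ≤ √B := fun i => by
    refine Real.le_sqrt_of_sq_le ?_
    have := hterm i; have := hksum i
    have := sq_nonneg (s.mu i - e.mu i); have := sq_nonneg (s.lam i - e.lam i)
    linarith
  have hlam : ∀ i, ‖s.lam i - e.lam i‖ ≤ √B := fun i => by
    refine Real.le_sqrt_of_sq_le ?_
    rw [Real.norm_eq_abs, sq_abs]
    have := hterm i; have := hksum i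
    have := sq_nonneg (s.mu i - e.mu i); have := sq_nonneg ‖s.xi i - e.xi i‖
    linarith
  have hmu : ∀ i, ‖s.mu i - e.mu i‖ ≤ √B := fun i => by
    refine Real.le_sqrt_of_sq_le ?_
    rw [Real.norm_eq_abs, sq_abs]
    have := hterm i; have := hksum i
    have := sq_nonneg (s.lam i - e.lam i); have := sq_nonneg ‖s.xi i - e.xi i‖
    linarith
  have hn : ‖s - e‖ ≤ √B := by
    have h0 := Real.sqrt_nonneg B
    refine norm_prod_le_iff.2 ⟨?_, norm_prod_le_iff.2 ⟨?_, norm_prod_le_iff.2 ⟨?_, ?_⟩⟩⟩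
    · exact (pi_norm_le_iff_of_nonneg h0).2 fun i =>
        (pi_norm_le_iff_of_nonneg h0).2 fun k => hrho i k
    · exact (pi_norm_le_iff_of_nonneg h0).2 hxi
    · exact (pi_norm_le_iff_of_nonneg h0).2 hlam
    · exact (pi_norm_le_iff_of_nonneg h0).2 hmu
  calc ‖s - e‖ ^ 2 ≤ √B ^ 2 := by gcongr
    _ = B := Real.sq_sqrt hB

/-! ### Trajectories: boundedness and vanishing velocities -/

theorem exists_tendsto_of_antitoneOn {u : ℝ → ℝ} (hu : AntitoneOn u (Ici 0))
    (h0 : ∀ t, 0 ≤ t → 0 ≤ u t) : ∃ l, Tendsto u atTop (𝓝 l) := by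
  have hanti : Antitone fun t => u (max t 0) := fun t s hts =>
    hu (le_max_right t 0) (le_max_right s 0) (max_le_max_right 0 hts)
  have hlim := tendsto_atTop_ciInf hanti
    ⟨0, by rintro _ ⟨t, rfl⟩; exact h0 _ (le_max_right t 0)⟩
  refine ⟨_, hlim.congr' ?_⟩
  filter_upwards [eventually_ge_atTop 0] with t ht
  rw [max_eq_left ht]

/-- The data of the algorithm together with a trajectory that starts with positive `λ`. -/
structure ConvexTrajectory (P : Problem N n) (a : Matrix (Fin N) (Fin N) ℝ)
    (b c : Fin N → Fin m → ℝ) (X : ℝ → State N m n) : Prop where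
  f_convex : ∀ i, ConvexOn ℝ univ (P.f i)
  f_smooth : ∀ i, TwiceDifferentiable (P.f i)
  g_convex : ∀ i, ConvexOn ℝ univ (P.g i)
  g_smooth : ∀ i, TwiceDifferentiable (P.g i)
  symm : ∀ i j, a i j = a j i
  nonneg : ∀ i j, 0 ≤ a i j
  compensator : ∀ i, IsCompensator (b i) (c i)
  trajectory : IsTrajectory P a b c X
  pos : ∀ i, 0 < (X 0).lam i

namespace ConvexTrajectory

variable {P : Problem N n} {a : Matrix (Fin N) (Fin N) ℝ} {b c : Fin N → Fin m → ℝ}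
  {X : ℝ → State N m n} (H : ConvexTrajectory P a b c X)
include H

theorem c_pos (i : Fin N) (k : Fin m) : 0 < c i k := (H.compensator i).pos k

theorem b_pos (i : Fin N) {k : Fin m} (hk : (k : ℕ) ≠ 0) : 0 < b i k := by
  have h2 := (H.compensator i).two_le
  have h0 := (H.compensator i).zero ⟨0, by omega⟩ rfl
  rw [← h0]
  exact (H.compensator i).strictMono (Fin.lt_def.2 (Nat.pos_of_ne_zero hk))

theorem b_nonneg (i : Fin N) (k : Fin m) : 0 ≤ b i k := by
  by_cases hk : (k : ℕ) = 0
  · exact ((H.compensator i).zero k hk).ge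
  · exact (H.b_pos i hk).le

theorem continuousOn : ContinuousOn X (Ici 0) := fun t ht =>
  (H.trajectory t ht).continuousWithinAt

theorem hasDerivWithinAt_rho (i : Fin N) (k : Fin m) {t : ℝ} (ht : 0 ≤ t) :
    HasDerivWithinAt (fun t => (X t).rho i k)
      (-(b i k • (X t).rho i k) + c i k • nu P a (X t) i) (Ici 0) t :=
  hasDerivWithinAt_pi.1 (hasDerivWithinAt_pi.1 (H.trajectory t ht).fst i) k

theorem hasDerivWithinAt_xi (i : Fin N) {t : ℝ} (ht : 0 ≤ t) :
    HasDerivWithinAt (fun t => (X t).xi i) (diffusion a (X t).x i) (Ici 0) t :=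
  hasDerivWithinAt_pi.1 (H.trajectory t ht).snd.fst i

theorem hasDerivWithinAt_lam (i : Fin N) {t : ℝ} (ht : 0 ≤ t) :
    HasDerivWithinAt (fun t => (X t).lam i) (2 * (X t).lam i * P.g i ((X t).x i)) (Ici 0) t :=
  hasDerivWithinAt_pi.1 (H.trajectory t ht).snd.snd.fst i

theorem hasDerivWithinAt_mu (i : Fin N) {t : ℝ} (ht : 0 ≤ t) :
    HasDerivWithinAt (fun t => (X t).mu i) (P.h i ((X t).x i)) (Ici 0) t :=
  hasDerivWithinAt_pi.1 (H.trajectory t ht).snd.snd.snd i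

theorem hasDerivWithinAt_x (i : Fin N) {t : ℝ} (ht : 0 ≤ t) :
    HasDerivWithinAt (fun t => (X t).x i)
      (∑ k, (-(b i k • (X t).rho i k) + c i k • nu P a (X t) i)) (Ici 0) t :=
  HasDerivWithinAt.fun_sum fun k _ => H.hasDerivWithinAt_rho i k ht

theorem lam_pos (i : Fin N) {t : ℝ} (ht : 0 ≤ t) : 0 < (X t).lam i := by
  refine pos_of_hasDerivWithinAt_mul (u := fun t => (X t).lam i)
    (w := fun t => 2 * P.g i ((X t).x i)) ?_ (fun t ht => ?_) (H.pos i) t ht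
  · exact (((H.g_smooth i).1.continuous.comp (continuous_state_x (m := m) i)).comp_continuousOn
      H.continuousOn).const_mul 2
  · exact (H.hasDerivWithinAt_lam i ht).congr_deriv (by ring)

theorem hasDerivWithinAt_lyapunov (e : State N m n) {t : ℝ} (ht : 0 ≤ t) :
    HasDerivWithinAt (fun t => lyapunov c e (X t)) (lyapunovRate P a b c e (X t)) (Ici 0) t := by
  unfold lyapunov lyapunovRate
  refine HasDerivWithinAt.fun_sum fun i _ => ?_
  refine HasDerivWithinAt.fun_add (HasDerivWithinAt.fun_add (HasDerivWithinAt.fun_add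
    (HasDerivWithinAt.fun_sum fun k _ => ?_) ?_) ?_) ?_
  · have h := (((H.hasDerivWithinAt_rho i k ht).sub_const (e.rho i k)).norm_sq).const_mul
      (2 * c i k)⁻¹
    refine h.congr_deriv ?_
    have := (H.c_pos i k).ne'
    field_simp
  · have h := (((H.hasDerivWithinAt_xi i ht).sub_const (e.xi i)).norm_sq).div_const 2
    refine h.congr_deriv ?_
    ring
  · have h := (((H.hasDerivWithinAt_mu i ht).sub_const (e.mu i)).pow 2).div_const 2
    refine h.congr_deriv ?_
    simp
    ring
  · exact hasDerivWithinAt_barrier (H.lam_pos i ht) (H.hasDerivWithinAt_lam i ht)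

theorem rate_le {e : State N m n} (he : IsAnchor P a b e) (s : State N m n) :
    lyapunovRate P a b c e s ≤ -dissipation a b c s + ∑ i, s.lam i ^ 2 * P.g i (e.x i) :=
  lyapunovRate_le H.f_convex (fun i => (H.f_smooth i).1) H.g_convex (fun i => (H.g_smooth i).1)
    H.symm H.c_pos he s

theorem rate_le_neg_dissipation {e : State N m n} (he : IsAnchor P a b e)
    (hg : ∀ i, P.g i (e.x i) ≤ 0) (s : State N m n) :
    lyapunovRate P a b c e s ≤ -dissipation a b c s := by
  have h := H.rate_le he s
  have : ∑ i, s.lam i ^ 2 * P.g i (e.x i) ≤ 0 :=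
    Finset.sum_nonpos fun i _ => mul_nonpos_of_nonneg_of_nonpos (sq_nonneg _) (hg i)
  linarith

theorem dissipation_nonneg (s : State N m n) : 0 ≤ dissipation a b c s :=
  DistOpt.dissipation_nonneg H.nonneg H.b_nonneg H.c_pos s

theorem antitoneOn_lyapunov {e : State N m n} (he : IsAnchor P a b e)
    (hg : ∀ i, P.g i (e.x i) ≤ 0) : AntitoneOn (fun t => lyapunov c e (X t)) (Ici 0) :=
  antitoneOn_of_hasDerivWithinAt_Ici le_rfl (fun _ ht => H.hasDerivWithinAt_lyapunov e ht)
    (convex_Ici 0) Subset.rfl fun t _ => by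
      have := H.rate_le_neg_dissipation he hg (X t)
      have := H.dissipation_nonneg (X t)
      linarith

theorem gap_le (e : State N m n) (he : ∀ i, 0 ≤ e.lam i) {t : ℝ} (ht : 0 ≤ t) :
    gap c e (X t) ≤ lyapunov c e (X t) :=
  gap_le_lyapunov c he fun i => H.lam_pos i ht

theorem exists_tendsto_lyapunov {e : State N m n} (he : IsAnchor P a b e)
    (hg : ∀ i, P.g i (e.x i) ≤ 0) : ∃ l, Tendsto (fun t => lyapunov c e (X t)) atTop (𝓝 l) :=
  exists_tendsto_of_antitoneOn (H.antitoneOn_lyapunov he hg) fun _ ht =>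
    (gap_nonneg H.c_pos _ _).trans (H.gap_le e he.lam_nonneg ht)

theorem exists_norm_le {e : State N m n} (he : IsAnchor P a b e) (hg : ∀ i, P.g i (e.x i) ≤ 0) :
    ∃ R, ∀ t, 0 ≤ t → ‖X t‖ ≤ R := by
  obtain ⟨K, hK, hgap⟩ := exists_norm_sq_le_gap (n := n) H.c_pos
  refine ⟨√(K * lyapunov c e (X 0)) + ‖e‖, fun t ht => ?_⟩
  have h1 : ‖X t - e‖ ≤ √(K * lyapunov c e (X 0)) := by
    refine Real.le_sqrt_of_sq_le ((hgap e (X t)).trans (mul_le_mul_of_nonneg_left ?_ hK.le))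
    exact (H.gap_le e he.lam_nonneg ht).trans
      (H.antitoneOn_lyapunov he hg (mem_Ici.2 le_rfl) ht ht)
  have h2 := norm_sub_norm_le (X t) e
  linarith

theorem exists_pos_le_lam {e : State N m n} (he : IsAnchor P a b e)
    (hg : ∀ i, P.g i (e.x i) ≤ 0) {i : Fin N} (hi : 0 < e.lam i) :
    ∃ δ > 0, ∀ t, 0 ≤ t → δ ≤ (X t).lam i := by
  obtain ⟨δ, hδ, h⟩ := exists_pos_le_of_barrier_le hi (lyapunov c e (X 0))
  refine ⟨δ, hδ, fun t ht => h _ (H.lam_pos i ht) ?_⟩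
  exact (barrier_le_lyapunov H.c_pos he.lam_nonneg (fun i => H.lam_pos i ht) i).trans
    (H.antitoneOn_lyapunov he hg (mem_Ici.2 le_rfl) ht ht)

section Bounded

variable {R : ℝ} (hR : ∀ t, 0 ≤ t → ‖X t‖ ≤ R)
include hR

omit H in
theorem exists_norm_comp_le {F : Type*} [NormedAddCommGroup F] {φ : State N m n → F}
    (hφ : Continuous φ) : ∃ C, ∀ t, 0 ≤ t → ‖φ (X t)‖ ≤ C := by
  obtain ⟨C, hC⟩ := (isCompact_closedBall (0 : State N m n) R).exists_bound_of_continuousOn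
    hφ.continuousOn
  exact ⟨C, fun t ht => hC _ (by simpa using hR t ht)⟩

/-- A bounded trajectory is Lipschitz, so continuous functions of it are uniformly continuous. -/
theorem uniformContinuousOn_comp {F : Type*} [NormedAddCommGroup F] {φ : State N m n → F}
    (hφ : Continuous φ) : UniformContinuousOn (fun t => φ (X t)) (Ici 0) := by
  obtain ⟨C, hC⟩ := exists_norm_comp_le hR (continuous_field H.f_smooth H.g_smooth a b c)
  have hC0 : 0 ≤ C := (norm_nonneg _).trans (hC 0 le_rfl)
  have hLip : LipschitzOnWith ⟨C, hC0⟩ X (Ici 0) :=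
    (convex_Ici 0).lipschitzOnWith_of_nnnorm_hasDerivWithin_le
      (fun t ht => H.trajectory t ht) fun t ht => hC t ht
  exact ((isCompact_closedBall (0 : State N m n) R).uniformContinuousOn_of_continuous
    hφ.continuousOn).comp hLip.uniformContinuousOn fun t ht => by simpa using hR t ht

theorem tendsto_dissipation {e : State N m n} (he : IsAnchor P a b e)
    (hg : ∀ i, P.g i (e.x i) ≤ 0) : Tendsto (fun t => dissipation a b c (X t)) atTop (𝓝 0) := by
  obtain ⟨l, hl⟩ := H.exists_tendsto_lyapunov he hg
  have h := tendsto_zero_of_uniformContinuousOn_deriv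
    (fun t ht => H.hasDerivWithinAt_lyapunov e ht)
    (H.uniformContinuousOn_comp hR (continuous_lyapunovRate H.f_smooth H.g_smooth a b c e)) hl
  refine squeeze_zero (fun t => H.dissipation_nonneg _) (fun t => ?_)
    (by simpa using h.neg)
  have := H.rate_le_neg_dissipation he hg (X t)
  linarith

theorem tendsto_rho {e : State N m n} (he : IsAnchor P a b e)
    (hg : ∀ i, P.g i (e.x i) ≤ 0) (i : Fin N) {k : Fin m} (hk : (k : ℕ) ≠ 0) :
    Tendsto (fun t => (X t).rho i k) atTop (𝓝 0) := by
  have hb := H.b_pos i hk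
  have hc := H.c_pos i k
  have hle : ∀ s : State N m n, ‖s.rho i k‖ ^ 2 ≤ c i k / b i k * dissipation a b c s := by
    intro s
    have h0 : ∀ i k, 0 ≤ (c i k)⁻¹ * b i k * ‖s.rho i k‖ ^ 2 := fun i k => by
      have := H.c_pos i k
      have := H.b_nonneg i k
      positivity
    have h1 := (Finset.single_le_sum (fun k _ => h0 i k) (Finset.mem_univ k)).trans
      (Finset.single_le_sum (f := fun i => ∑ k, (c i k)⁻¹ * b i k * ‖s.rho i k‖ ^ 2)
        (fun i _ => Finset.sum_nonneg fun k _ => h0 i k) (Finset.mem_univ i))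
    have h2 : (c i k)⁻¹ * b i k * ‖s.rho i k‖ ^ 2 ≤ dissipation a b c s :=
      h1.trans (le_add_of_nonneg_right (disagreement_nonneg H.nonneg _))
    calc ‖s.rho i k‖ ^ 2 = c i k / b i k * ((c i k)⁻¹ * b i k * ‖s.rho i k‖ ^ 2) := by field_simp
      _ ≤ _ := by gcongr
  have hsq : Tendsto (fun t => ‖(X t).rho i k‖ ^ 2) atTop (𝓝 0) :=
    squeeze_zero (fun t => by positivity) (fun t => hle (X t))
      (by simpa using (H.tendsto_dissipation hR he hg).const_mul (c i k / b i k))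
  rw [tendsto_zero_iff_norm_tendsto_zero]
  simpa [Real.sqrt_sq] using hsq.sqrt

/-- The input `ν` tends to `0`, by Barbalat's lemma for a compensator state that
does not integrate; this uses `m ≥ 2`. -/
theorem tendsto_nu {e : State N m n} (he : IsAnchor P a b e)
    (hg : ∀ i, P.g i (e.x i) ≤ 0) (i : Fin N) :
    Tendsto (fun t => nu P a (X t) i) atTop (𝓝 0) := by
  let k : Fin m := ⟨1, (H.compensator i).two_le⟩
  have hk := H.tendsto_rho hR he hg i (k := k) (by simp [k])
  have hcont : Continuous fun s : State N m n => -(b i k • s.rho i k) + c i k • nu P a s i :=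
    ((continuous_rho i k).const_smul (b i k)).neg.add
      ((continuous_nu H.f_smooth H.g_smooth a i).const_smul (c i k))
  have h := tendsto_zero_of_uniformContinuousOn_deriv
    (fun t ht => H.hasDerivWithinAt_rho i k ht) (H.uniformContinuousOn_comp hR hcont) hk
  have h2 := (h.add (hk.const_smul (b i k))).const_smul (c i k)⁻¹
  have hc := (H.c_pos i k).ne'
  simpa [smul_smul, hc] using h2

theorem tendsto_x_deriv {e : State N m n} (he : IsAnchor P a b e)
    (hg : ∀ i, P.g i (e.x i) ≤ 0) (i : Fin N) :
    Tendsto (fun t => ∑ k, (-(b i k • (X t).rho i k) + c i k • nu P a (X t) i)) atTop (𝓝 0) := by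
  have hk : ∀ k, Tendsto (fun t => -(b i k • (X t).rho i k) + c i k • nu P a (X t) i)
      atTop (𝓝 0) := by
    intro k
    have h2 := (H.tendsto_nu hR he hg i).const_smul (c i k)
    by_cases h0 : (k : ℕ) = 0
    · simpa [(H.compensator i).zero k h0] using h2
    · simpa using ((H.tendsto_rho hR he hg i h0).const_smul (b i k)).neg.add h2
  simpa using tendsto_finsetSum Finset.univ fun k _ => hk k

/-- Smooth functions of `xᵢ` vary slowly at infinity. -/
theorem slowly_varying {e : State N m n} (he : IsAnchor P a b e)
    (hg : ∀ i, P.g i (e.x i) ≤ 0) (i : Fin N) {φ : E n → ℝ} (hφ : Differentiable ℝ φ)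
    (hφ' : Continuous (gradient φ)) :
    ∀ ε > 0, ∃ T, ∀ t s, T ≤ t → t ≤ s →
      |φ ((X s).x i) - φ ((X t).x i)| ≤ ε * (s - t) := by
  intro ε hε
  obtain ⟨C, hC⟩ := exists_norm_comp_le hR (hφ'.comp (continuous_state_x (m := m) i))
  have hd : ∀ t, 0 ≤ t → HasDerivWithinAt (fun t => φ ((X t).x i))
      (inner ℝ (gradient φ ((X t).x i))
        (∑ k, (-(b i k • (X t).rho i k) + c i k • nu P a (X t) i))) (Ici 0) t := fun t ht => by
    have h := (hφ ((X t).x i)).hasGradientAt.hasFDerivAt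
    exact h.comp_hasDerivWithinAt t (H.hasDerivWithinAt_x i ht)
  have hC0 : 0 ≤ C := (norm_nonneg _).trans (hC 0 le_rfl)
  obtain ⟨T, hT⟩ := Metric.tendsto_atTop.1 (H.tendsto_x_deriv hR he hg i) (ε / (C + 1))
    (by positivity)
  refine ⟨max T 0, fun t s ht hts => ?_⟩
  have h := norm_sub_sub_smul_le hd (v := 0) (C := ε) ((le_max_right _ _).trans ht) hts
    fun r hr => by
      have hr0 : 0 ≤ r := (le_max_right _ _).trans (ht.trans hr.1)
      have h1 := hT r ((le_max_left _ _).trans (ht.trans hr.1))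
      rw [dist_zero_right] at h1
      rw [sub_zero]
      refine (norm_inner_le_norm _ _).trans ?_
      calc _ ≤ C * (ε / (C + 1)) := mul_le_mul (hC r hr0) h1.le (norm_nonneg _) hC0
        _ ≤ (C + 1) * (ε / (C + 1)) := by gcongr; linarith
        _ = ε := by field_simp
  simpa using h

theorem tendsto_h {e : State N m n} (he : IsAnchor P a b e)
    (hg : ∀ i, P.g i (e.x i) ≤ 0) (i : Fin N) :
    Tendsto (fun t => P.h i ((X t).x i)) atTop (𝓝 0) := by
  obtain ⟨C, hC⟩ := exists_norm_comp_le hR (continuous_mu i)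
  obtain ⟨v, hv⟩ := exists_hasGradientAt_affine (P.h i)
  rw [tendsto_zero_iff_norm_tendsto_zero, Metric.tendsto_atTop']
  intro ε hε
  have h := eventually_abs_le_of_slowly_varying (fun t ht => H.hasDerivWithinAt_mu i ht)
    (H.slowly_varying hR he hg i (fun x => (hv x).differentiableAt)
      (continuous_gradient_affine (P.h i)))
    (fun t ht => (le_abs_self _).trans (hC t ht)) C (half_pos hε)
  obtain ⟨T, hT⟩ := eventually_atTop.1 h
  refine ⟨max T 0, fun t ht => ?_⟩
  have h1 := hT t ((le_max_left _ _).trans ht.le)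
    (neg_le_of_abs_le (hC t ((le_max_right _ _).trans ht.le)))
  simp only [dist_zero_right, Real.norm_eq_abs, abs_abs]
  linarith

/-- While `λᵢ` is not small, the constraint `gᵢ` is almost active. -/
theorem eventually_abs_g_le {e : State N m n} (he : IsAnchor P a b e)
    (hg : ∀ i, P.g i (e.x i) ≤ 0) (i : Fin N) {δ ε : ℝ} (hδ : 0 < δ) (hε : 0 < ε) :
    ∀ᶠ t in atTop, δ ≤ (X t).lam i → |P.g i ((X t).x i)| ≤ ε := by
  obtain ⟨C, hC⟩ := exists_norm_comp_le hR (continuous_lam i)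
  have hd : ∀ t, 0 ≤ t → HasDerivWithinAt (fun t => Real.log ((X t).lam i) / 2)
      (P.g i ((X t).x i)) (Ici 0) t := fun t ht => by
    have h0 := (H.lam_pos i ht).ne'
    refine (((H.hasDerivWithinAt_lam i ht).log h0).div_const 2).congr_deriv ?_
    field_simp
  have h := eventually_abs_le_of_slowly_varying hd
    (H.slowly_varying hR he hg i (H.g_smooth i).1 (H.g_smooth i).continuous_gradient)
    (M := C / 2) (fun t ht => ?_) (-(Real.log δ / 2)) hε
  · filter_upwards [h] with t ht hδt
    refine ht ?_
    have := Real.log_le_log hδ hδt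
    linarith
  · have h1 := Real.log_le_self (H.lam_pos i ht).le
    have h2 := (le_abs_self _).trans (hC t ht)
    linarith

end Bounded

end ConvexTrajectory

/-! ### Limit points of a trajectory -/

theorem tendsto_comp_of_continuousAt {X : ℝ → State N m n} {F : Filter ℝ} {Y : State N m n}
    (hY : Tendsto X F (𝓝 Y)) {α : Type*} [TopologicalSpace α] {φ : State N m n → α}
    (hφ : ContinuousAt φ Y) : Tendsto (fun t => φ (X t)) F (𝓝 (φ Y)) :=
  hφ.tendsto.comp hY

/-- A bounded trajectory converges along every ultrafilter at infinity. -/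
theorem exists_tendsto_ultrafilter {X : ℝ → State N m n} {R : ℝ}
    (hR : ∀ t, 0 ≤ t → ‖X t‖ ≤ R) {G : Ultrafilter ℝ} (hG : (G : Filter ℝ) ≤ atTop) :
    ∃ Y, Tendsto X G (𝓝 Y) := by
  obtain ⟨Y, -, hY⟩ := (isCompact_closedBall (0 : State N m n) R).ultrafilter_le_nhds (G.map X)
    (by
      rw [le_principal_iff, Ultrafilter.mem_coe, Ultrafilter.mem_map]
      refine hG ?_
      filter_upwards [eventually_ge_atTop 0] with t ht
      simpa using hR t ht)
  exact ⟨Y, hY⟩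

/-- By convexity the Lagrangian is minimal wherever its gradient vanishes. -/
theorem lagrangian_le_of_stationary {P : Problem N n}
    (hf : ∀ i, ConvexOn ℝ univ (P.f i)) (hfd : ∀ i, Differentiable ℝ (P.f i))
    (hg : ∀ i, ConvexOn ℝ univ (P.g i)) (hgd : ∀ i, Differentiable ℝ (P.g i))
    {a : Matrix (Fin N) (Fin N) ℝ} {x ξ : Fin N → E n} {lam μ : Fin N → ℝ}
    (h0 : ∀ i, gradient (P.f i) (x i) + lam i ^ 2 • gradient (P.g i) (x i)
      + μ i • gradient (P.h i) (x i) + diffusion a ξ i = 0) (y : Fin N → E n) :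
    lagrangian P a x ξ lam μ ≤ lagrangian P a y ξ lam μ := by
  refine Finset.sum_le_sum fun i _ => ?_
  have h1 := convexOn_add_inner_gradient_le (hf i) (hfd i) (x i) (y i)
  have h2 := mul_le_mul_of_nonneg_left
    (convexOn_add_inner_gradient_le (hg i) (hgd i) (x i) (y i)) (sq_nonneg (lam i))
  have h3 := affine_eq_add_inner_gradient (P.h i) (x i) (y i)
  have h4 := congrArg (fun v => inner ℝ v (y i - x i)) (h0 i)
  simp only [inner_add_left, real_inner_smul_left, inner_zero_left] at h4
  rw [real_inner_comm (y i - x i) (diffusion a ξ i), inner_sub_left] at h4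
  rw [h3]
  linarith

/-- The state whose outputs are all equal to `z`, with given multipliers. -/
noncomputable def consensusState (z : E n) (ξ : Fin N → E n) (lam μ : Fin N → ℝ) : State N m n :=
  (fun _ k => if (k : ℕ) = 0 then z else 0, ξ, lam, μ)

theorem consensusState_x (hm : 0 < m) (z : E n) (ξ : Fin N → E n) (lam μ : Fin N → ℝ) :
    (consensusState z ξ lam μ : State N m n).x = fun _ => z := by
  funext i
  simp only [State.x, State.rho, consensusState]
  rw [Finset.sum_eq_single ⟨0, hm⟩ (fun k _ hk => if_neg fun h => hk (Fin.ext h)) (by simp)]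
  simp

/-- The outputs of `e` with the multipliers of `s`. -/
def swapMultipliers (e s : State N m n) : State N m n := (e.rho, s.xi, s.lam, s.mu)

namespace ConvexTrajectory

variable {P : Problem N n} {a : Matrix (Fin N) (Fin N) ℝ} {b c : Fin N → Fin m → ℝ}
  {X : ℝ → State N m n} (H : ConvexTrajectory P a b c X)
include H

section LimitPoints

variable {e : State N m n} (he : IsAnchor P a b e) (hg : ∀ i, P.g i (e.x i) ≤ 0)
  {F : Filter ℝ} [NeBot F] (hF : F ≤ atTop) {Y : State N m n} (hY : Tendsto X F (𝓝 Y))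
include he hg hF hY

omit he hg in
theorem limit_lam_nonneg (i : Fin N) : 0 ≤ Y.lam i :=
  ge_of_tendsto (tendsto_comp_of_continuousAt hY (continuous_lam i).continuousAt)
    (hF (by filter_upwards [eventually_ge_atTop 0] with t ht using (H.lam_pos i ht).le))

theorem limit_rho (i : Fin N) {k : Fin m} (hk : (k : ℕ) ≠ 0) : Y.rho i k = 0 := by
  obtain ⟨R, hR⟩ := H.exists_norm_le he hg
  exact tendsto_nhds_unique (tendsto_comp_of_continuousAt hY (continuous_rho i k).continuousAt)
    ((H.tendsto_rho hR he hg i hk).mono_left hF)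

theorem limit_nu (i : Fin N) : nu P a Y i = 0 := by
  obtain ⟨R, hR⟩ := H.exists_norm_le he hg
  exact tendsto_nhds_unique
    (tendsto_comp_of_continuousAt hY (continuous_nu H.f_smooth H.g_smooth a i).continuousAt)
    ((H.tendsto_nu hR he hg i).mono_left hF)

theorem limit_diffusion : diffusion a Y.x = 0 := by
  obtain ⟨R, hR⟩ := H.exists_norm_le he hg
  have hcont : Continuous fun s : State N m n => disagreement a s.x := by
    have := continuous_state_x (N := N) (m := m) (n := n)
    unfold disagreement
    fun_prop
  refine diffusion_eq_zero_of_disagreement H.nonneg (le_of_tendsto_of_tendsto'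
    (tendsto_comp_of_continuousAt hY hcont.continuousAt)
    ((H.tendsto_dissipation hR he hg).mono_left hF) fun t => le_add_of_nonneg_left ?_)
  refine Finset.sum_nonneg fun i _ => Finset.sum_nonneg fun k _ => ?_
  have := H.c_pos i k
  have := H.b_nonneg i k
  positivity

theorem limit_h (i : Fin N) : P.h i (Y.x i) = 0 := by
  obtain ⟨R, hR⟩ := H.exists_norm_le he hg
  exact tendsto_nhds_unique
    (tendsto_comp_of_continuousAt hY
      ((continuous_affine (P.h i)).comp (continuous_state_x (m := m) i)).continuousAt)
    ((H.tendsto_h hR he hg i).mono_left hF)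

theorem limit_g {i : Fin N} (hi : 0 < Y.lam i) : P.g i (Y.x i) = 0 := by
  obtain ⟨R, hR⟩ := H.exists_norm_le he hg
  have hlim := tendsto_comp_of_continuousAt hY
    ((H.g_smooth i).1.continuous.comp (continuous_state_x (m := m) i)).continuousAt
  have hlam : ∀ᶠ t in F, Y.lam i / 2 ≤ (X t).lam i :=
    (tendsto_comp_of_continuousAt hY (continuous_lam i).continuousAt).eventually
      (eventually_ge_nhds (half_lt_self hi))
  refine abs_nonpos_iff.1 (le_of_forall_pos_le_add fun ε hε => ?_)
  rw [zero_add]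
  refine le_of_tendsto hlim.abs ?_
  filter_upwards [hlam, hF (H.eventually_abs_g_le hR he hg i (half_pos hi) hε)] with t h1 h2
  exact h2 h1

theorem limit_slackness (i : Fin N) : Y.lam i * P.g i (Y.x i) = 0 := by
  rcases (H.limit_lam_nonneg hF hY i).eq_or_lt with h | h
  · rw [← h, zero_mul]
  · rw [H.limit_g he hg hF hY h, mul_zero]

theorem limit_stationary (i : Fin N) :
    gradient (P.f i) (Y.x i) + Y.lam i ^ 2 • gradient (P.g i) (Y.x i)
      + Y.mu i • gradient (P.h i) (Y.x i) + diffusion a Y.xi i = 0 := by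
  have h := H.limit_nu he hg hF hY i
  rw [nu_eq, H.limit_diffusion he hg hF hY, Pi.zero_apply, add_zero] at h
  rw [← neg_eq_zero, ← h]
  abel

theorem limit_dual (y : Fin N → E n) :
    ∑ i, P.f i (Y.x i) ≤ lagrangian P a y Y.xi Y.lam Y.mu := by
  refine le_trans (le_of_eq ?_) (lagrangian_le_of_stationary H.f_convex
    (fun i => (H.f_smooth i).1) H.g_convex (fun i => (H.g_smooth i).1)
    (H.limit_stationary he hg hF hY) y)
  rw [lagrangian_of_diffusion_eq_zero P H.symm (H.limit_diffusion he hg hF hY)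
    (H.limit_h he hg hF hY), left_eq_add]
  refine Finset.sum_eq_zero fun i _ => ?_
  rw [pow_two, mul_assoc, H.limit_slackness he hg hF hY i, mul_zero]

theorem limit_isAnchor : IsAnchor P a b Y where
  rest i k := by
    by_cases hk : (k : ℕ) = 0
    · rw [(H.compensator i).zero k hk, zero_smul]
    · rw [H.limit_rho he hg hF hY i hk, smul_zero]
  consensus := H.limit_diffusion he hg hF hY
  eq_zero := H.limit_h he hg hF hY
  lam_nonneg := H.limit_lam_nonneg hF hY
  dual := H.limit_dual he hg hF hY

/-- The objective value of a limit point is not below that of a feasible anchor `e`: the constraints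
with a positive multiplier in `e` are active at the limit point. -/
theorem sum_f_le_limit : ∑ i, P.f i (e.x i) ≤ ∑ i, P.f i (Y.x i) := by
  refine (he.dual Y.x).trans (le_of_eq ?_)
  rw [lagrangian_of_diffusion_eq_zero P H.symm (H.limit_diffusion he hg hF hY)
    (H.limit_h he hg hF hY), add_eq_left]
  refine Finset.sum_eq_zero fun i _ => ?_
  rcases (he.lam_nonneg i).eq_or_lt with h | h
  · rw [← h]; ring
  · obtain ⟨δ, hδ, hle⟩ := H.exists_pos_le_lam he hg h
    have hpos : 0 < Y.lam i := hδ.trans_le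
      (ge_of_tendsto (tendsto_comp_of_continuousAt hY (continuous_lam i).continuousAt)
        (hF (by filter_upwards [eventually_ge_atTop 0] with t ht using hle t ht)))
    rw [H.limit_g he hg hF hY hpos, mul_zero]

/-- The multipliers of a limit point are dual optimal. -/
theorem swapMultipliers_isAnchor : IsAnchor P a b (swapMultipliers e Y) where
  rest := he.rest
  consensus := he.consensus
  eq_zero := he.eq_zero
  lam_nonneg i := H.limit_lam_nonneg hF hY i
  dual y := (H.sum_f_le_limit he hg hF hY).trans (H.limit_dual he hg hF hY y)

omit H he hg hF hY [NeBot F] in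
theorem lyapunov_eq_gap {s r : State N m n} (h : s.lam = r.lam) :
    lyapunov c r s = gap c r s := by
  unfold lyapunov gap
  simp [h, barrier_self]

/-- All limit points have the same `λ`. The Lyapunov function relative to `swapMultipliers e Y`
converges; its limit is the value at `Y`, which is the distance of `Y.rho` from `e.rho`, and it is
at least the gap at any other limit point `Z`. Exchanging `Y` and `Z` and adding gives the claim. -/
theorem limit_lam_unique {F' : Filter ℝ} [NeBot F'] (hF' : F' ≤ atTop) {Z : State N m n}
    (hZ : Tendsto X F' (𝓝 Z)) : Y.lam = Z.lam := by
  have key : ∀ {F F' : Filter ℝ} [NeBot F] [NeBot F'], F ≤ atTop → F' ≤ atTop →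
      ∀ {Y Z : State N m n}, Tendsto X F (𝓝 Y) → Tendsto X F' (𝓝 Z) →
      gap c (swapMultipliers e Y) Z ≤ gap c (swapMultipliers e Y) Y := by
    intro F F' _ _ hF hF' Y Z hY hZ
    have hA := H.swapMultipliers_isAnchor he hg hF hY
    obtain ⟨l, hl⟩ := H.exists_tendsto_lyapunov hA hg
    have h1 : l = lyapunov c (swapMultipliers e Y) Y :=
      tendsto_nhds_unique (hl.mono_left hF)
        (tendsto_comp_of_continuousAt hY (continuousAt_lyapunov c rfl))
    rw [← lyapunov_eq_gap (s := Y) (r := swapMultipliers e Y) rfl, ← h1]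
    refine le_of_tendsto_of_tendsto
      (tendsto_comp_of_continuousAt hZ (continuous_gap c (swapMultipliers e Y)).continuousAt)
      (hl.mono_left hF') (hF' ?_)
    filter_upwards [eventually_ge_atTop 0] with t ht
    exact H.gap_le _ hA.lam_nonneg ht
  have h1 := key hF hF' hY hZ
  have h2 := key hF' hF hZ hY
  have hsplit : ∀ A B : State N m n, gap c (swapMultipliers e A) B
      = ∑ i, ∑ k, (2 * c i k)⁻¹ * ‖B.rho i k - e.rho i k‖ ^ 2 + ∑ i, ‖B.xi i - A.xi i‖ ^ 2 / 2
        + ∑ i, (B.mu i - A.mu i) ^ 2 / 2 + ∑ i, (B.lam i - A.lam i) ^ 2 / 4 := by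
    intro A B
    simp only [gap, ← Finset.sum_add_distrib]
    rfl
  rw [hsplit, hsplit] at h1 h2
  simp only [sub_self, norm_zero, ne_eq, OfNat.ofNat_ne_zero, not_false_eq_true, zero_pow, zero_div,
    Finset.sum_const_zero, add_zero] at h1 h2
  have hxi : ∀ A B : State N m n, 0 ≤ ∑ i, ‖B.xi i - A.xi i‖ ^ 2 / 2 := fun A B =>
    Finset.sum_nonneg fun i _ => by positivity
  have hmu : ∀ A B : State N m n, 0 ≤ ∑ i, (B.mu i - A.mu i) ^ 2 / 2 := fun A B =>
    Finset.sum_nonneg fun i _ => by positivity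
  have hlam : ∀ A B : State N m n, 0 ≤ ∑ i, (B.lam i - A.lam i) ^ 2 / 4 := fun A B =>
    Finset.sum_nonneg fun i _ => by positivity
  have hz : ∑ i, (Z.lam i - Y.lam i) ^ 2 / 4 = 0 := by
    linarith [hxi Y Z, hxi Z Y, hmu Y Z, hmu Z Y, hlam Y Z, hlam Z Y]
  rw [Finset.sum_eq_zero_iff_of_nonneg fun i _ => by positivity] at hz
  funext i
  have := hz i (Finset.mem_univ i)
  have h3 : (Z.lam i - Y.lam i) ^ 2 = 0 := by linarith
  linarith [pow_eq_zero_iff (two_ne_zero) |>.1 h3]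

theorem tendsto_lam (i : Fin N) : Tendsto (fun t => (X t).lam i) atTop (𝓝 (Y.lam i)) := by
  obtain ⟨R, hR⟩ := H.exists_norm_le he hg
  rw [tendsto_iff_ultrafilter]
  intro G hG
  obtain ⟨Z, hZ⟩ := exists_tendsto_ultrafilter hR hG
  rw [H.limit_lam_unique he hg hF hY hG hZ]
  exact tendsto_comp_of_continuousAt hZ (continuous_lam i).continuousAt

/-- Limit points satisfy the inequality constraints. If `gⱼ > 0` at a limit point `Y` for `j ∈ J`,
then `λⱼ → 0`, and near `Y` the growth of the Lyapunov function relative to `Y` is paid for by the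
growth of the small quantity `∑_{j ∈ J} λⱼ²`. So the trajectory never leaves a neighbourhood of `Y`
after a late visit, and there `λⱼ` does not decrease: a contradiction. -/
theorem limit_g_nonpos (j : Fin N) : P.g j (Y.x j) ≤ 0 := by
  classical
  by_contra! hj
  have hA := H.limit_isAnchor he hg hF hY
  set J : Finset (Fin N) := Finset.univ.filter fun i => 0 < P.g i (Y.x i) with hJ
  have hJY : ∀ i ∈ J, Y.lam i = 0 := fun i hi => by
    have h := H.limit_slackness he hg hF hY i
    exact (mul_eq_zero.1 h).resolve_right (Finset.mem_filter.1 hi).2.ne'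
  -- a level of the Lyapunov function below which the violated constraints stay violated
  obtain ⟨θ, hθ, hlevel⟩ : ∃ θ > 0, ∀ t, 0 ≤ t → lyapunov c Y (X t) ≤ θ →
      ∀ i ∈ J, P.g i (Y.x i) / 2 ≤ P.g i ((X t).x i) := by
    have hnear : ∀ᶠ s in 𝓝 Y, ∀ i ∈ J, P.g i (Y.x i) / 2 ≤ P.g i (s.x i) := by
      rw [Finset.eventually_all]
      exact fun i hi => (((H.g_smooth i).1.continuous.comp
        (continuous_state_x (m := m) i)).tendsto Y).eventually
          (eventually_ge_nhds (half_lt_self (Finset.mem_filter.1 hi).2))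
    obtain ⟨δ, hδ, hball⟩ := Metric.eventually_nhds_iff.1 hnear
    obtain ⟨K, hK, hgap⟩ := exists_norm_sq_le_gap (n := n) H.c_pos
    refine ⟨δ ^ 2 / (2 * K), by positivity, fun t ht hV => hball ?_⟩
    rw [dist_eq_norm]
    refine lt_of_pow_lt_pow_left₀ 2 hδ.le ?_
    calc ‖X t - Y‖ ^ 2 ≤ K * gap c Y (X t) := hgap _ _
      _ ≤ K * (δ ^ 2 / (2 * K)) :=
        mul_le_mul_of_nonneg_left ((H.gap_le Y hA.lam_nonneg ht).trans hV) hK.le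
      _ = δ ^ 2 / 2 := by field_simp
      _ < δ ^ 2 := by linarith [pow_pos hδ 2]
  set Λ : ℝ → ℝ := fun t => ∑ i ∈ J, (X t).lam i ^ 2 / 2 with hΛ
  have hΛ0 : ∀ t, 0 ≤ Λ t := fun t => Finset.sum_nonneg fun i _ => by positivity
  have hΛlim : Tendsto Λ atTop (𝓝 0) := by
    have : ∀ i ∈ J, Tendsto (fun t => (X t).lam i ^ 2 / 2) atTop (𝓝 0) := fun i hi => by
      have h := ((H.tendsto_lam he hg hF hY i).pow 2).div_const 2
      simpa [hJY i hi] using h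
    simpa using tendsto_finsetSum J this
  have hVF : Tendsto (fun t => lyapunov c Y (X t)) F (𝓝 0) := by
    have h := tendsto_comp_of_continuousAt hY (continuousAt_lyapunov c (e := Y) (s := Y) rfl)
    rwa [lyapunov_eq_gap rfl, show gap c Y Y = 0 by simp [gap]] at h
  obtain ⟨T, hT⟩ := eventually_atTop.1
    ((hΛlim.eventually (gt_mem_nhds (show (0 : ℝ) < θ / 4 by positivity))).and
      (eventually_ge_atTop 0))
  obtain ⟨t₁, ht₁V, ht₁T⟩ :=
    ((hVF.eventually (gt_mem_nhds (show (0 : ℝ) < θ / 4 by positivity))).and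
    (hF (eventually_ge_atTop T))).exists
  have ht₁ : 0 ≤ t₁ := (hT t₁ ht₁T).2
  have hderiv : ∀ t, 0 ≤ t → HasDerivWithinAt (fun t => lyapunov c Y (X t) - Λ t)
      (lyapunovRate P a b c Y (X t) - ∑ i ∈ J, 2 * (X t).lam i ^ 2 * P.g i ((X t).x i))
      (Ici 0) t := fun t ht => by
    refine (H.hasDerivWithinAt_lyapunov Y ht).sub (HasDerivWithinAt.fun_sum fun i _ => ?_)
    refine (((H.hasDerivWithinAt_lam i ht).pow 2).div_const 2).congr_deriv ?_
    simp
    ring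
  have hrate : ∀ t, 0 ≤ t → lyapunov c Y (X t) ≤ θ →
      lyapunovRate P a b c Y (X t)
        - ∑ i ∈ J, 2 * (X t).lam i ^ 2 * P.g i ((X t).x i) ≤ 0 := by
    intro t ht hV
    have h1 := H.rate_le hA (X t)
    have h2 := H.dissipation_nonneg (X t)
    have h3 : ∑ i, (X t).lam i ^ 2 * P.g i (Y.x i)
        ≤ ∑ i ∈ J, (X t).lam i ^ 2 * P.g i (Y.x i) := by
      rw [← Finset.sum_filter_add_sum_filter_not Finset.univ (fun i => 0 < P.g i (Y.x i))]
      refine add_le_of_nonpos_right (Finset.sum_nonpos fun i hi => ?_)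
      exact mul_nonpos_of_nonneg_of_nonpos (sq_nonneg _) (not_lt.1 (Finset.mem_filter.1 hi).2)
    have h4 : ∑ i ∈ J, (X t).lam i ^ 2 * P.g i (Y.x i)
        ≤ ∑ i ∈ J, 2 * (X t).lam i ^ 2 * P.g i ((X t).x i) := by
      refine Finset.sum_le_sum fun i hi => ?_
      have h5 := mul_le_mul_of_nonneg_left (hlevel t ht hV i hi) (sq_nonneg ((X t).lam i))
      linarith
    linarith
  have hstay := forall_lt_of_bootstrap (φ := fun t => lyapunov c Y (X t)) (T := t₁) (θ := θ)
    (fun t ht => ((H.hasDerivWithinAt_lyapunov Y (ht₁.trans ht)).continuousWithinAt).mono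
      (Ici_subset_Ici.2 ht₁)) (by linarith) (fun t ht hs => by
      have hanti := antitoneOn_of_hasDerivWithinAt_Ici ht₁ hderiv (convex_Icc t₁ t)
        Icc_subset_Ici_self fun r hr => hrate r (ht₁.trans hr.1) (hs r hr)
      have h1 := hanti (left_mem_Icc.2 ht) (right_mem_Icc.2 ht) ht
      have h2 := (hT t (ht₁T.trans ht)).1
      have h3 := hΛ0 t₁
      simp only at h1 h2 ⊢
      linarith)
  have hjJ : j ∈ J := Finset.mem_filter.2 ⟨Finset.mem_univ j, hj⟩
  have hmono := antitoneOn_of_hasDerivWithinAt_Ici (u := fun t => -(X t).lam j) ht₁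
    (fun t ht => (H.hasDerivWithinAt_lam j ht).neg) (convex_Ici t₁) Subset.rfl fun t ht => by
      have ht0 : 0 ≤ t := ht₁.trans ht
      have h1 := hlevel t ht0 (hstay t ht).le j hjJ
      have h2 := H.lam_pos j ht0
      have h3 : 0 ≤ 2 * (X t).lam j * P.g j ((X t).x j) :=
        mul_nonneg (by positivity) (by linarith)
      linarith
  have hle : (X t₁).lam j ≤ Y.lam j :=
    ge_of_tendsto (H.tendsto_lam he hg hF hY j) (by
      filter_upwards [eventually_ge_atTop t₁] with t ht
      exact neg_le_neg_iff.1 (hmono (mem_Ici.2 le_rfl) ht ht))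
  rw [hJY j hjJ] at hle
  exact absurd (H.lam_pos j ht₁) (not_lt.2 hle)

/-- A limit point is an admissible reference state, so the Lyapunov function relative to it is
nonincreasing, and it tends to `0` along `F`. -/
theorem tendsto_limit : Tendsto X atTop (𝓝 Y) := by
  have hA := H.limit_isAnchor he hg hF hY
  obtain ⟨l, hl⟩ := H.exists_tendsto_lyapunov hA (H.limit_g_nonpos he hg hF hY)
  have h := tendsto_comp_of_continuousAt hY (continuousAt_lyapunov c (e := Y) (s := Y) rfl)
  rw [lyapunov_eq_gap rfl, show gap c Y Y = 0 by simp [gap]] at h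
  rw [tendsto_nhds_unique (hl.mono_left hF) h] at hl
  obtain ⟨K, hK, hgap⟩ := exists_norm_sq_le_gap (n := n) H.c_pos
  have hsq : Tendsto (fun t => ‖X t - Y‖ ^ 2) atTop (𝓝 0) := by
    refine tendsto_of_tendsto_of_tendsto_of_le_of_le' tendsto_const_nhds
      (by simpa using hl.const_mul K) (Eventually.of_forall fun t => by positivity) ?_
    filter_upwards [eventually_ge_atTop 0] with t ht
    exact (hgap Y (X t)).trans
      (mul_le_mul_of_nonneg_left (H.gap_le Y hA.lam_nonneg ht) hK.le)
  rw [tendsto_iff_norm_sub_tendsto_zero]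
  simpa [Real.sqrt_sq] using hsq.sqrt

theorem limit_isEquilibrium : IsEquilibrium P a b c Y := by
  have hA := H.limit_isAnchor he hg hF hY
  refine Prod.ext ?_ (Prod.ext ?_ (Prod.ext ?_ ?_))
  · funext i k
    simp [field, hA.rest, H.limit_nu he hg hF hY i]
  · exact hA.consensus
  · funext i
    simp only [field, mul_assoc, H.limit_slackness he hg hF hY i, mul_zero]
    rfl
  · exact funext hA.eq_zero

theorem limit_generalizedKKT : P.GeneralizedKKT a Y.x Y.xi Y.lam Y.mu := by
  have hA := H.limit_isAnchor he hg hF hY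
  refine ⟨by rw [lapl_eq_neg_diffusion, hA.consensus, neg_zero],
    fun i => ⟨hA.eq_zero i, H.limit_g_nonpos he hg hF hY i, ?_⟩, H.limit_stationary he hg hF hY⟩
  rw [pow_two, mul_assoc, H.limit_slackness he hg hF hY i, mul_zero]

theorem limit_solvesConsensus : P.SolvesConsensus a Y.x := by
  have hK := H.limit_generalizedKKT he hg hF hY
  refine ⟨⟨fun i => ⟨(hK.2.1 i).2.1, (hK.2.1 i).1⟩, hK.1⟩, fun y hy => ?_⟩
  have hd : diffusion a y = 0 := by
    have := hy.2
    rwa [lapl_eq_neg_diffusion, neg_eq_zero] at this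
  have h := H.limit_dual he hg hF hY y
  rw [lagrangian_of_diffusion_eq_zero P H.symm hd fun i => (hy.1 i).2] at h
  have hle : ∑ i, Y.lam i ^ 2 * P.g i (y i) ≤ 0 :=
    Finset.sum_nonpos fun i _ => mul_nonpos_of_nonneg_of_nonpos (sq_nonneg _) (hy.1 i).1
  simp only [Problem.consensusObjective, hy.2, hK.1, Pi.zero_apply, inner_zero_right,
    Finset.sum_const_zero, add_zero]
  linarith

end LimitPoints

end ConvexTrajectory

end DistOpt

theorem theorem1 {N m n : ℕ} (P : DistOpt.Problem N n)
    (hf : ∀ i, ConvexOn ℝ Set.univ (P.f i)) (hf2 : ∀ i, DistOpt.TwiceDifferentiable (P.f i))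
    (hg : ∀ i, ConvexOn ℝ Set.univ (P.g i)) (hg2 : ∀ i, DistOpt.TwiceDifferentiable (P.g i))
    (hSlater : P.Slater) (hOpt : ∃ z, P.IsOptimal z)
    (G : SimpleGraph (Fin N)) (hG : G.Connected)
    (a : Matrix (Fin N) (Fin N) ℝ) (ha : DistOpt.IsWeightedAdjacency G a)
    (b c : Fin N → Fin m → ℝ) (hbc : ∀ i, DistOpt.IsCompensator (b i) (c i))
    (X : ℝ → DistOpt.State N m n) (hX : DistOpt.IsTrajectory P a b c X)
    (hpos : ∀ i, 0 < (X 0).lam i) :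
    ∃ s : DistOpt.State N m n,
      DistOpt.IsEquilibrium P a b c s ∧
      P.GeneralizedKKT a s.x s.xi s.lam s.mu ∧
      P.SolvesConsensus a s.x ∧
      Filter.Tendsto X Filter.atTop (nhds s) := by
  have H : DistOpt.ConvexTrajectory P a b c X :=
    ⟨hf, hf2, hg, hg2, ha.symm, ha.nonneg, hbc, hX, hpos⟩
  obtain ⟨z, hz⟩ := hOpt
  obtain ⟨ξ, lam, μ, hlam, hdual⟩ := DistOpt.exists_dual_optimal P hf (fun i => (hf2 i).1) hg
    (fun i => (hg2 i).1) hSlater hG ha hz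
  have hm : 0 < m := by
    have := (hbc hG.nonempty.some).two_le
    omega
  set e : DistOpt.State N m n := DistOpt.consensusState z ξ lam μ
  have hx : e.x = fun _ => z := DistOpt.consensusState_x hm z ξ lam μ
  have he : DistOpt.IsAnchor P a b e :=
    { rest := fun i k => by
        by_cases hk : (k : ℕ) = 0
        · rw [(hbc i).zero k hk, zero_smul]
        · have : e.rho i k = 0 := if_neg hk
          rw [this, smul_zero]
      consensus := by rw [hx]; funext i; simp [DistOpt.diffusion]
      eq_zero := fun i => by rw [hx]; exact (hz.1 i).2
      lam_nonneg := hlam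
      dual := fun y => by rw [hx]; exact hdual y }
  have heg : ∀ i, P.g i (e.x i) ≤ 0 := fun i => by rw [hx]; exact (hz.1 i).1
  obtain ⟨R, hR⟩ := H.exists_norm_le he heg
  have hF : (Ultrafilter.of (Filter.atTop : Filter ℝ) : Filter ℝ) ≤ Filter.atTop :=
    Ultrafilter.of_le _
  obtain ⟨Y, hYF⟩ := DistOpt.exists_tendsto_ultrafilter hR hF
  exact ⟨Y, H.limit_isEquilibrium he heg hF hYF, H.limit_generalizedKKT he heg hF hYF,
    H.limit_solvesConsensus he heg hF hYF, H.tendsto_limit he heg hF hYF⟩
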